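/- Let $n\ge 2$ and let $R$ be an $n$-dimensional Cohen–Macaulay local ring with maximal ideal $\mathfrak m$, let $x_1,\dots,x_n$ be a system of parameters of $R$, and put $Q=(x_1,\dots,x_n)R$. Let $$0\to F_n\xrightarrow{\varphi_n}F_{n-1}\to\cdots\to F_1\xrightarrow{\varphi_1}F_0$$ be an acyclic complex of finitely generated free $R$-modules with $\operatorname{Im}\varphi_n\subseteq QF_{n-1}$; put $M=\operatorname{Im}\varphi_1$ and $M:_{F_0}Q=\{z\in F_0 : Qz\subseteq M\}$. Fix a free basis $\{v_\lambda\}_{\lambda\in\Lambda}$ of $F_n$ and elements $v_{(\lambda,i)}\in F_{n-1}$ ($\lambda\in\Lambda$, $1\le i\le n$) with $\varphi_n(v_\lambda)=\sum_{i=1}^n x_i v_{(\lambda,i)}$ for all $\lambda$. Let $K_\bullet=K_\bullet(x_1,\dots,x_n)$ be the Koszul complex: $K_p$ is free with basis $e_I$, $I\subseteq N:=\{1,\dots,n\}$, $\sharp I=p$, and $\partial_p(e_I)=\sum_{i\in I}(-1)^{\sharp\{j\in I:\,j<i\}}x_i\,e_{I\setminus\{i\}}$. Call a chain map $\sigma_\bullet:F_n\otimes_R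 K_\bullet\to F_\bullet$ admissible if $\sigma_{n-1}(v_\lambda\otimes e_{N\setminus\{i\}})=(-1)^{n+i-1}v_{(\lambda,i)}$ for all $\lambda\in\Lambda$, $1\le i\le n$, and $\sigma_n(v_\lambda\otimes e_N)=(-1)^n v_\lambda$ for all $\lambda$. Suppose that there is a subset $U$ of $F_{n-1}$ such that the family of all the $v_{(\lambda,i)}$ together with $U$ is a free basis of $F_{n-1}$. Then an admissible chain map exists, and for every admissible $\sigma_\bullet$ the following holds. Put ${}^*F_0=F_0$, ${}^*F_p=(F_n\otimes K_{p-1})\oplus F_p$ for $1\le p\le n-2$, and let ${}^*F_{n-1}$ be the submodule of $(F_n\otimes K_{n-2})\oplus F_{n-1}$ generated by the elements $(v_\lambda\otimes e_I,0)$ ($\lambda\in\Lambda$, $\sharp I=n-2$) and $(0,u)$ ($u\in U$). Let ${}^*\varphi_1(g,f)=\sigma_0(g)+\varphi_1(f)$ and ${}^*\varphi_p(g,f)=\big((F_n\otimes\partial_{p-1})(g),\,(-1)^{p-1}\sigma_{p-1}(g)+\varphi_p(f)\big)$ for $2\le p\le n-1$, restricted to ${}^*F_p$. Then $$0\to{}^*F_{n-1}\xrightarrow{{}^*\varphi_{n-1}}{}^*F_{n-2}\to\cdots\to{}^*F_1\xrightarrow{{}^*\varphi_1}{}^*F_0=F_0$$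 is an acyclic complex of finitely generated free $R$-modules and $\operatorname{Im}{}^*\varphi_1=M:_{F_0}Q$, so that it is a free resolution of $F_0/(M:_{F_0}Q)$ of length $n-1$. Consequently $\operatorname{depth}_R F_0/(M:_{F_0}Q)>0$ (with the convention that the zero module has depth $\infty$). -/

import Mathlib

open scoped TensorProduct

universe u v w

/-- The depth of a module `M` over a local ring: the supremum of the lengths of the `M`-regular
sequences in the maximal ideal. Weakly regular sequences are used, which for a nonzero finitely
generated module over a Noetherian local ring are the regular ones (Nakayama); the zero module gets
depth `⊤`, the usual convention `depth 0 = ∞`. -/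
noncomputable def moduleDepth (R : Type u) [CommRing R] [IsLocalRing R]
    (M : Type v) [AddCommGroup M] [Module R M] : ℕ∞ :=
  ⨆ (rs : List R) (_ : (∀ r ∈ rs, r ∈ IsLocalRing.maximalIdeal R) ∧
    RingTheory.Sequence.IsWeaklyRegular M rs), (rs.length : ℕ∞)

/-- A Cohen-Macaulay local ring: a Noetherian local ring whose depth equals its dimension. -/
structure IsCohenMacaulayLocal (R : Type u) [CommRing R] [IsLocalRing R] : Prop where
  noetherian : IsNoetherianRing R
  depth_eq_dim : (moduleDepth R R : WithBot ℕ∞) = ringKrullDim R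

/-- `x₁, …, xₙ` is a system of parameters: `n = dim R` and `(x₁, …, xₙ)R` is primary to the
maximal ideal. -/
structure IsSystemOfParameters {R : Type u} [CommRing R] [IsLocalRing R] {n : ℕ}
    (x : Fin n → R) : Prop where
  dim_eq : ringKrullDim R = n
  radical_eq : (Ideal.span (Set.range x)).radical = IsLocalRing.maximalIdeal R

/-- The submodule `M :_G Q = {z ∈ G | Q z ⊆ M}` of `G`. -/
def moduleColon {R : Type u} [CommRing R] {G : Type v} [AddCommGroup G] [Module R G]
    (M : Submodule R G) (Q : Ideal R) : Submodule R G where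
  carrier := {z | ∀ a ∈ Q, a • z ∈ M}
  add_mem' := fun hy hz a ha => by
    rw [smul_add]
    exact M.add_mem (hy a ha) (hz a ha)
  zero_mem' := fun a _ => by simp
  smul_mem' := fun c z hz a ha => by
    rw [smul_comm]
    exact M.smul_mem c (hz a ha)

/-- `0 → X_ℓ → ⋯ → X₁ → X₀` is an acyclic complex of finitely generated free modules, of length
(at most) `ℓ`: the differential `X (p+1) → X p` is `d p`, and the homology at `X p` vanishes for
all `p ≥ 1` (exactness includes that composites of consecutive differentials are zero). -/
structure IsFreeAcyclicComplex {R : Type u} [CommRing R] (X : ℕ → Type v)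
    [∀ p, AddCommGroup (X p)] [∀ p, Module R (X p)] (d : ∀ p, X (p + 1) →ₗ[R] X p) (ℓ : ℕ) :
    Prop where
  free : ∀ p, Module.Free R (X p)
  finite : ∀ p, Module.Finite R (X p)
  vanish : ∀ p, ℓ < p → Subsingleton (X p)
  exact : ∀ p, Function.Exact (d (p + 1)) (d p)

namespace Koszul

/-- The set `N_p` of `p`-element subsets of the index set. -/
abbrev Index (n p : ℕ) : Type := {I : Finset (Fin n) // I.card = p}

/-- `K_p`, the free module with basis `e_I`, `I ∈ N_p`. -/
abbrev K (R : Type u) [CommRing R] (n p : ℕ) : Type u := Index n p →₀ R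

/-- The basis element `e_I` of `K_p`. -/
noncomputable def e (R : Type u) [CommRing R] {n p : ℕ} (I : Index n p) : K R n p :=
  Finsupp.single I 1

/-- `I \ {i}` for `i ∈ I`. -/
def Index.erase {n p : ℕ} (I : Index n (p + 1)) (i : I.1) : Index n p :=
  ⟨I.1.erase i.1, by rw [Finset.card_erase_of_mem i.2, I.2]; rfl⟩

/-- `s(i, I) = #{j ∈ I | j < i}`. -/
def s {n : ℕ} (i : Fin n) (I : Finset (Fin n)) : ℕ := (I.filter (fun j => j < i)).card

/-- The boundary map `K_{p+1} → K_p`, `∂ e_I = ∑_{i ∈ I} (-1)^{s(i, I)} x_i e_{I \ {i}}`. -/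
noncomputable def boundary {R : Type u} [CommRing R] {n : ℕ} (x : Fin n → R) (p : ℕ) :
    K R n (p + 1) →ₗ[R] K R n p :=
  Finsupp.linearCombination R fun I : Index n (p + 1) =>
    ∑ i : I.1, ((-1) ^ s i.1 I.1 * x i.1) • e R (I.erase i)

/-- The whole index set `N` as the element of `N_n`. -/
def Index.full (n : ℕ) : Index n n := ⟨Finset.univ, by simp⟩

/-- `N \ {i}` as an element of `N_{n-1}`. -/
def Index.compl {m : ℕ} (i : Fin (m + 1)) : Index (m + 1) m :=
  ⟨Finset.univ.erase i, by simp⟩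

end Koszul

namespace StarTransform

open Koszul

section Cone

variable {R : Type u} [CommRing R] {n : ℕ}

/-- The modules of the mapping cone of a chain map `G ⊗ K_• → F_•`: `F₀` in degree `0`, and
`(G ⊗ K_p) ⊕ F_{p+1}` in degree `p + 1`. -/
def Cone (R : Type u) [CommRing R] (n : ℕ) (G : Type u) [AddCommGroup G] [Module R G]
    (F : ℕ → Type u) [∀ p, AddCommGroup (F p)] [∀ p, Module R (F p)] : ℕ → Type u
  | 0 => F 0
  | p + 1 => (G ⊗[R] K R n p) × F (p + 1)

variable {G : Type u} [AddCommGroup G] [Module R G]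
  {F : ℕ → Type u} [∀ p, AddCommGroup (F p)] [∀ p, Module R (F p)]

noncomputable instance (p : ℕ) : AddCommGroup (Cone R n G F p) :=
  match p with
  | 0 => inferInstanceAs (AddCommGroup (F 0))
  | p + 1 => inferInstanceAs (AddCommGroup ((G ⊗[R] K R n p) × F (p + 1)))

noncomputable instance (p : ℕ) : Module R (Cone R n G F p) :=
  match p with
  | 0 => inferInstanceAs (Module R (F 0))
  | p + 1 => inferInstanceAs (Module R ((G ⊗[R] K R n p) × F (p + 1)))

/-- Degree `0` of the cone is `F₀`. -/
noncomputable def coneZero (R : Type u) [CommRing R] (n : ℕ) (G : Type u) [AddCommGroup G]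
    [Module R G] (F : ℕ → Type u) [∀ p, AddCommGroup (F p)] [∀ p, Module R (F p)] :
    Cone R n G F 0 ≃ₗ[R] F 0 :=
  LinearEquiv.refl R (F 0)

/-- Degree `p + 1` of the cone is `(G ⊗ K_p) ⊕ F_{p+1}`. -/
noncomputable def coneSucc (R : Type u) [CommRing R] (n : ℕ) (G : Type u) [AddCommGroup G]
    [Module R G] (F : ℕ → Type u) [∀ p, AddCommGroup (F p)] [∀ p, Module R (F p)] (p : ℕ) :
    Cone R n G F (p + 1) ≃ₗ[R] (G ⊗[R] K R n p) × F (p + 1) :=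
  LinearEquiv.refl R ((G ⊗[R] K R n p) × F (p + 1))

/-- The differentials of the mapping cone of `σ : G ⊗ K_•(x) → F_•`:
`(g, f) ↦ σ₀ g + φ₁ f` in degree `1`, and
`(g, f) ↦ ((G ⊗ ∂_{p-1}) g, (-1)^{p-1} σ_{p-1} g + φ_p f)` in degree `p ≥ 2`.
Here `φ p` is the differential `F_{p+1} → F_p`. -/
noncomputable def coneMap (x : Fin n → R) (φ : ∀ p, F (p + 1) →ₗ[R] F p)
    (σ : ∀ p, G ⊗[R] K R n p →ₗ[R] F p) :
    ∀ p, Cone R n G F (p + 1) →ₗ[R] Cone R n G F p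
  | 0 => (coneZero R n G F).symm ∘ₗ ((σ 0).coprod (φ 0)) ∘ₗ (coneSucc R n G F 0)
  | p + 1 => (coneSucc R n G F p).symm ∘ₗ
      (LinearMap.prod
        ((LinearMap.lTensor G (boundary x p)) ∘ₗ LinearMap.fst R _ _)
        (((-1 : R) ^ (p + 1) • σ (p + 1)).coprod (φ (p + 1)))) ∘ₗ
      (coneSucc R n G F (p + 1))

end Cone

section Transform

/- In this section `n = k + 2`. -/
variable {R : Type u} [CommRing R] {k : ℕ}
  {F : ℕ → Type u} [∀ p, AddCommGroup (F p)] [∀ p, Module R (F p)] {Λ : Type w}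

/-- `σ : F_n ⊗ K_•(x) → F_•` is a chain map with
`σ_{n-1}(v_λ ⊗ e_{N \ {i}}) = (-1)^{n+i-1} v_{(λ,i)}` and `σ_n(v_λ ⊗ e_N) = (-1)^n v_λ`, where
`v_λ = b λ` and `v_{(λ,i)} = v λ i`. As `Fin n` is numbered from `0`, the exponent `n + i - 1`
reads `n + i` here. -/
structure IsAdmissible (x : Fin (k + 2) → R) (φ : ∀ p, F (p + 1) →ₗ[R] F p)
    (b : Module.Basis Λ R (F (k + 2))) (v : Λ → Fin (k + 2) → F (k + 1))
    (σ : ∀ p, F (k + 2) ⊗[R] K R (k + 2) p →ₗ[R] F p) : Prop where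
  comm : ∀ p, φ p ∘ₗ σ (p + 1) = σ p ∘ₗ LinearMap.lTensor (F (k + 2)) (boundary x p)
  sub_top : ∀ l i, σ (k + 1) (b l ⊗ₜ e R (Index.compl i)) = (-1 : R) ^ (k + 2 + i.1) • v l i
  top : ∀ l, σ (k + 2) (b l ⊗ₜ e R (Index.full (k + 2))) = (-1 : R) ^ (k + 2) • b l

/-- The submodule `*F_{n-1}` of `(F_n ⊗ K_{n-2}) ⊕ F_{n-1}` generated by the elements
`(v_λ ⊗ e_I, 0)` with `λ ∈ Λ`, `I ∈ N_{n-2}`, and `(0, u)` with `u ∈ U`. -/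
noncomputable def starTop (b : Module.Basis Λ R (F (k + 2))) (U : Set (F (k + 1))) :
    Submodule R (Cone R (k + 2) (F (k + 2)) F (k + 1)) :=
  Submodule.map (coneSucc R (k + 2) (F (k + 2)) F k).symm.toLinearMap <|
    Submodule.span R
      (Set.range (fun q : Λ × Index (k + 2) k => (b q.1 ⊗ₜ[R] e R q.2, (0 : F (k + 1)))) ∪
        (fun u => ((0 : F (k + 2) ⊗[R] K R (k + 2) k), u)) '' U)

/-- The terms of the truncated complex, as submodules of the mapping cone: the whole term in degrees
`p ≤ n - 2`, the submodule `*F_{n-1}` in degree `n - 1`, and `0` in degrees `p ≥ n`. -/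
noncomputable def starSub (b : Module.Basis Λ R (F (k + 2))) (U : Set (F (k + 1))) :
    ∀ p, Submodule R (Cone R (k + 2) (F (k + 2)) F p) :=
  Function.update (fun p => if p ≤ k then ⊤ else ⊥) (k + 1) (starTop b U)

theorem starSub_of_le (b : Module.Basis Λ R (F (k + 2))) (U : Set (F (k + 1))) {p : ℕ}
    (hp : p ≤ k) : starSub b U p = ⊤ := by
  rw [starSub, Function.update_of_ne (by omega), if_pos hp]

theorem starSub_top (b : Module.Basis Λ R (F (k + 2))) (U : Set (F (k + 1))) :
    starSub b U (k + 1) = starTop b U := by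
  rw [starSub, Function.update_self]

theorem starSub_of_lt (b : Module.Basis Λ R (F (k + 2))) (U : Set (F (k + 1))) {p : ℕ}
    (hp : k + 1 < p) : starSub b U p = ⊥ := by
  rw [starSub, Function.update_of_ne (by omega), if_neg (by omega)]

theorem coneMap_mem_starSub (x : Fin (k + 2) → R) (φ : ∀ p, F (p + 1) →ₗ[R] F p)
    (b : Module.Basis Λ R (F (k + 2))) (U : Set (F (k + 1)))
    (σ : ∀ p, F (k + 2) ⊗[R] K R (k + 2) p →ₗ[R] F p) (p : ℕ) :
    ∀ z ∈ starSub b U (p + 1), coneMap x φ σ p z ∈ starSub b U p := by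
  intro z hz
  rcases Nat.lt_or_ge k p with h | h
  · rw [starSub_of_lt b U (by omega), Submodule.mem_bot] at hz
    rw [hz, map_zero]
    exact Submodule.zero_mem _
  · rw [starSub_of_le b U h]
    exact Submodule.mem_top

/-- The differentials of the truncated complex: the restrictions of those of the cone. -/
noncomputable def starMap (x : Fin (k + 2) → R) (φ : ∀ p, F (p + 1) →ₗ[R] F p)
    (b : Module.Basis Λ R (F (k + 2))) (U : Set (F (k + 1)))
    (σ : ∀ p, F (k + 2) ⊗[R] K R (k + 2) p →ₗ[R] F p) (p : ℕ) :
    starSub b U (p + 1) →ₗ[R] starSub b U p :=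
  (coneMap x φ σ p).restrict (coneMap_mem_starSub x φ b U σ p)

/-- The augmentation `*F₀ = F₀ → F₀ / A`, the canonical surjection. -/
noncomputable def starAug (b : Module.Basis Λ R (F (k + 2))) (U : Set (F (k + 1)))
    (A : Submodule R (F 0)) : starSub b U 0 →ₗ[R] F 0 ⧸ A :=
  A.mkQ ∘ₗ (coneZero R (k + 2) (F (k + 2)) F).toLinearMap ∘ₗ (starSub b U 0).subtype

end Transform

end StarTransform

/-! Write `G = F_n`. The theorem rests on comparing the two ends of a chain map `ρ : K_• → F_•`: its
value `ρ_0(e_∅)` lies in `M` if and only if `ρ_n(e_N)` lies in `QF_n`. Both directions build a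
null-homotopy. Starting from degree `0`, exactness of `F_•` and freeness of `K_p` push it upward,
and `F_{n+1} = 0` leaves only `h ∘ ∂` at the top (`top_mem_of_zero_mem`). Starting from degree `n`,
vanishing of the Koszul cohomology with flat coefficients below degree `n` pushes it downward
(`zero_mem_of_top_mem`).

An admissible `σ` sends `g ⊗ e_N` to `±g`, and each `z ∈ M : Q` is the degree-zero value of a chain
map `K_• → F_•`. The comparison therefore shows that `σ_0` induces an isomorphism from `H_0(G ⊗ K_•)
= G/QG` onto `(M : Q)/M`. Since `G ⊗ K_•` has no homology in positive degrees, the mapping cone of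
`σ` resolves `F_0/(M : Q)`.

The cone is two steps too long, and its excess is contractible: `±σ_n` identifies `G ⊗ K_n` with the
summand `F_n`, and `±σ_{n-1}` carries a basis of `G ⊗ K_{n-1}` to the `v_(λ,i)` up to sign, leaving
`U` as a basis of a complement in `F_{n-1}`. Cancelling both pairs yields the truncated complex
(`exists_mem_starSub`, `eq_zero_of_mem_starTop`).

For the depth, a complex of length less than `n` has zero top value for every chain map, so the
comparison gives `M : Q = M` (`moduleColon_range_le`). Applied to the new complex, this says that
`Q` kills no nonzero element of `F_0/(M : Q)`, and prime avoidance produces a regular element in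
`Q`. -/

theorem linearMap_sum_comp {R M N P ι : Type*} [CommRing R] [AddCommGroup M] [Module R M]
    [AddCommGroup N] [Module R N] [AddCommGroup P] [Module R P] (t : Finset ι)
    (f : ι → N →ₗ[R] P) (g : M →ₗ[R] N) : (∑ i ∈ t, f i) ∘ₗ g = ∑ i ∈ t, f i ∘ₗ g := by
  ext m
  simp [LinearMap.sum_apply]

theorem linearMap_comp_sum {R M N P ι : Type*} [CommRing R] [AddCommGroup M] [Module R M]
    [AddCommGroup N] [Module R N] [AddCommGroup P] [Module R P] (t : Finset ι)
    (f : N →ₗ[R] P) (g : ι → M →ₗ[R] N) : f ∘ₗ (∑ i ∈ t, g i) = ∑ i ∈ t, f ∘ₗ g i := by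
  ext m
  simp [LinearMap.sum_apply]

/-! ### Contraction, exterior multiplication and homotopies on the Koszul complex -/

namespace Koszul

theorem s_insert {n : ℕ} (j : Fin n) {i : Fin n} {I : Finset (Fin n)} (hi : i ∉ I) :
    s j (insert i I) = s j I + if i < j then 1 else 0 := by
  unfold s
  rw [Finset.filter_insert]
  split_ifs with h
  · rw [Finset.card_insert_of_notMem (by simp [hi])]
  · rfl

theorem s_erase {n : ℕ} (j : Fin n) {i : Fin n} {I : Finset (Fin n)} (hi : i ∈ I) :
    s j I = s j (I.erase i) + if i < j then 1 else 0 := by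
  conv_lhs => rw [← Finset.insert_erase hi]
  exact s_insert j (Finset.notMem_erase i I)

variable {R : Type u} [CommRing R] {n : ℕ}

theorem index_isEmpty {p : ℕ} (h : n < p) : IsEmpty (Index n p) :=
  ⟨fun I => by
    have := Finset.card_le_univ I.1
    rw [I.2, Fintype.card_fin] at this
    omega⟩

theorem K_subsingleton {p : ℕ} (h : n < p) : Subsingleton (K R n p) :=
  haveI := index_isEmpty (n := n) h
  inferInstance

/-- `I ∪ {i}` for `i ∉ I`. -/
def Index.insert {p : ℕ} (I : Index n p) (i : Fin n) (hi : i ∉ I.1) : Index n (p + 1) :=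
  ⟨Insert.insert i I.1, by rw [Finset.card_insert_of_notMem hi, I.2]⟩

/-- The contraction with the `i`-th dual basis vector. -/
noncomputable def contract (R : Type u) [CommRing R] {n : ℕ} (i : Fin n) (p : ℕ) :
    K R n (p + 1) →ₗ[R] K R n p :=
  Finsupp.linearCombination R fun I : Index n (p + 1) =>
    if h : i ∈ I.1 then (-1 : R) ^ s i I.1 • e R (I.erase ⟨i, h⟩) else 0

/-- The exterior multiplication by the `i`-th basis vector. -/
noncomputable def wedge (R : Type u) [CommRing R] {n : ℕ} (i : Fin n) (p : ℕ) :
    K R n p →ₗ[R] K R n (p + 1) :=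
  Finsupp.linearCombination R fun I : Index n p =>
    if h : i ∈ I.1 then 0 else (-1 : R) ^ s i I.1 • e R (I.insert i h)

theorem contract_e_of_mem {i : Fin n} {p : ℕ} {I : Index n (p + 1)} (h : i ∈ I.1) :
    contract R i p (e R I) = (-1 : R) ^ s i I.1 • e R (I.erase ⟨i, h⟩) := by
  simp [contract, e, h]

theorem contract_e_of_notMem {i : Fin n} {p : ℕ} {I : Index n (p + 1)} (h : i ∉ I.1) :
    contract R i p (e R I) = 0 := by
  simp [contract, e, h]

theorem wedge_e_of_mem {i : Fin n} {p : ℕ} {I : Index n p} (h : i ∈ I.1) :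
    wedge R i p (e R I) = 0 := by
  simp [wedge, e, h]

theorem wedge_e_of_notMem {i : Fin n} {p : ℕ} {I : Index n p} (h : i ∉ I.1) :
    wedge R i p (e R I) = (-1 : R) ^ s i I.1 • e R (I.insert i h) := by
  simp [wedge, e, h]

theorem boundary_e (x : Fin n → R) {p : ℕ} (I : Index n (p + 1)) :
    boundary x p (e R I) = ∑ i : I.1, ((-1) ^ s i.1 I.1 * x i.1) • e R (I.erase i) := by
  simp [boundary, e]

theorem K_hom_ext {N : Type v} [AddCommGroup N] [Module R N] {p : ℕ} {f g : K R n p →ₗ[R] N}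
    (h : ∀ I, f (e R I) = g (e R I)) : f = g :=
  Finsupp.lhom_ext' fun I => LinearMap.ext_ring (h I)

theorem boundary_eq_sum (x : Fin n → R) (p : ℕ) :
    boundary x p = ∑ i, x i • contract R i p := by
  refine K_hom_ext fun I => ?_
  rw [boundary_e, LinearMap.sum_apply]
  have h : ∀ i : I.1, ((-1) ^ s i.1 I.1 * x i.1) • e R (I.erase i) =
      (x i.1 • contract R i.1 p) (e R I) := fun i => by
    rw [LinearMap.smul_apply, contract_e_of_mem i.2, smul_smul, mul_comm]
  rw [Finset.sum_congr rfl fun i _ => h i,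
    Finset.sum_coe_sort I.1 fun i => (x i • contract R i p) (e R I)]
  refine Finset.sum_subset (Finset.subset_univ _) fun i _ hi => ?_
  rw [LinearMap.smul_apply, contract_e_of_notMem hi, smul_zero]

theorem contract_contract_self (i : Fin n) (p : ℕ) :
    contract R i p ∘ₗ contract R i (p + 1) = 0 := by
  refine K_hom_ext fun I => ?_
  rw [LinearMap.comp_apply]
  by_cases hi : i ∈ I.1
  · rw [contract_e_of_mem hi, map_smul, contract_e_of_notMem (by simp [Index.erase]), smul_zero,
      LinearMap.zero_apply]
  · rw [contract_e_of_notMem hi, map_zero, LinearMap.zero_apply]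

theorem contract_contract_add {i j : Fin n} (hij : i ≠ j) (p : ℕ) :
    contract R i p ∘ₗ contract R j (p + 1) + contract R j p ∘ₗ contract R i (p + 1) = 0 := by
  refine K_hom_ext fun I => ?_
  simp only [LinearMap.add_apply, LinearMap.comp_apply, LinearMap.zero_apply]
  by_cases hi : i ∈ I.1
  · by_cases hj : j ∈ I.1
    · have hi' : i ∈ (I.erase ⟨j, hj⟩).1 := Finset.mem_erase.2 ⟨hij, hi⟩
      have hj' : j ∈ (I.erase ⟨i, hi⟩).1 := Finset.mem_erase.2 ⟨hij.symm, hj⟩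
      rw [contract_e_of_mem hi, contract_e_of_mem hj, map_smul, map_smul, contract_e_of_mem hi',
        contract_e_of_mem hj', smul_smul, smul_smul]
      have hI : (I.erase ⟨j, hj⟩).erase ⟨i, hi'⟩ = (I.erase ⟨i, hi⟩).erase ⟨j, hj'⟩ :=
        Subtype.ext Finset.erase_right_comm
      rw [hI, ← add_smul, s_erase i hj, s_erase j hi]
      simp only [Index.erase]
      -- Exactly one of the two exponents gains a one, according to which of `i`, `j` is smaller, so
      -- the two terms have opposite signs.
      rcases lt_or_gt_of_ne hij with h | h
      · rw [if_neg h.asymm, if_pos h]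
        convert zero_smul R _ using 2
        ring
      · rw [if_neg h.asymm, if_pos h]
        convert zero_smul R _ using 2
        ring
    · rw [contract_e_of_notMem hj, contract_e_of_mem hi, map_zero, map_smul,
        contract_e_of_notMem (fun h => hj (Finset.mem_of_mem_erase h)), smul_zero, add_zero]
  · rw [contract_e_of_notMem hi, map_zero, add_zero]
    by_cases hj : j ∈ I.1
    · rw [contract_e_of_mem hj, map_smul,
        contract_e_of_notMem (fun h => hi (Finset.mem_of_mem_erase h)), smul_zero]
    · rw [contract_e_of_notMem hj, map_zero]

theorem boundary_comp_boundary (x : Fin n → R) (p : ℕ) :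
    boundary x p ∘ₗ boundary x (p + 1) = 0 := by
  have h : boundary x p ∘ₗ boundary x (p + 1) =
      ∑ q : Fin n × Fin n, (x q.1 * x q.2) • (contract R q.1 p ∘ₗ contract R q.2 (p + 1)) := by
    rw [boundary_eq_sum, boundary_eq_sum, Fintype.sum_prod_type]
    simp only [linearMap_sum_comp, linearMap_comp_sum, LinearMap.smul_comp, LinearMap.comp_smul,
      Finset.smul_sum, smul_smul]
    rw [Finset.sum_comm]
    simp only [mul_comm]
  rw [h]
  -- Contractions anticommute and square to zero, so the pairs `(i, j)` and `(j, i)` cancel and the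
  -- diagonal vanishes.
  refine Finset.sum_involution (fun q _ => q.swap) ?_ ?_ (fun _ _ => Finset.mem_univ _)
    (fun _ _ => Prod.swap_swap _)
  · rintro ⟨i, j⟩ -
    by_cases hij : i = j
    · subst hij
      simp [contract_contract_self]
    · simp only [Prod.swap, mul_comm (x j) (x i), ← smul_add, contract_contract_add hij, smul_zero]
  · rintro ⟨i, j⟩ - hq hs
    simp only [Prod.swap, Prod.mk.injEq] at hs
    obtain ⟨rfl, -⟩ := hs
    exact hq (by simp [contract_contract_self])

theorem contract_wedge_zero (i j : Fin n) :
    contract R j 0 ∘ₗ wedge R i 0 = if i = j then LinearMap.id else 0 := by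
  refine K_hom_ext fun I => ?_
  have hI : I.1 = ∅ := Finset.card_eq_zero.1 I.2
  have hi : ∀ i, i ∉ I.1 := by simp [hI]
  rw [LinearMap.comp_apply, wedge_e_of_notMem (hi i), map_smul]
  split_ifs with hij
  · subst hij
    have hi' : i ∈ (I.insert i (hi i)).1 := Finset.mem_insert_self _ _
    rw [contract_e_of_mem hi', smul_smul]
    have : (I.insert i (hi i)).erase ⟨i, hi'⟩ = I :=
      Subtype.ext (Finset.erase_insert (hi i))
    rw [this]
    simp only [Index.insert]
    rw [s_insert i (hi i), if_neg (lt_irrefl i), add_zero, ← mul_pow]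
    simp
  · rw [contract_e_of_notMem, smul_zero, LinearMap.zero_apply]
    simp [Index.insert, hI, Ne.symm hij]

/-- The Clifford relation between contraction and exterior multiplication. Summed against `x_j`, it
makes `wedge R i` a homotopy between multiplication by `x_i` and zero. -/
theorem contract_wedge_succ (i j : Fin n) (p : ℕ) :
    contract R j (p + 1) ∘ₗ wedge R i (p + 1) + wedge R i p ∘ₗ contract R j p =
      if i = j then LinearMap.id else 0 := by
  refine K_hom_ext fun I => ?_
  rw [LinearMap.add_apply, LinearMap.comp_apply, LinearMap.comp_apply]
  by_cases hi : i ∈ I.1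
  · rw [wedge_e_of_mem hi, map_zero, zero_add]
    split_ifs with hij
    · subst hij
      have hi' : i ∉ (I.erase ⟨i, hi⟩).1 := Finset.notMem_erase _ _
      rw [contract_e_of_mem hi, map_smul, wedge_e_of_notMem hi', smul_smul]
      have : (I.erase ⟨i, hi⟩).insert i hi' = I := Subtype.ext (Finset.insert_erase hi)
      rw [this, s_erase i hi, if_neg (lt_irrefl i), add_zero]
      simp only [Index.erase]
      rw [← mul_pow]
      simp
    · by_cases hj : j ∈ I.1
      · rw [contract_e_of_mem hj, map_smul, wedge_e_of_mem, smul_zero, LinearMap.zero_apply]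
        exact Finset.mem_erase.2 ⟨hij, hi⟩
      · rw [contract_e_of_notMem hj, map_zero, LinearMap.zero_apply]
  · rw [wedge_e_of_notMem hi, map_smul]
    split_ifs with hij
    · subst hij
      have hi' : i ∈ (I.insert i hi).1 := Finset.mem_insert_self _ _
      rw [contract_e_of_mem hi', contract_e_of_notMem hi, map_zero, smul_smul, add_zero]
      have : (I.insert i hi).erase ⟨i, hi'⟩ = I := Subtype.ext (Finset.erase_insert hi)
      rw [this]
      simp only [Index.insert]
      rw [s_insert i hi, if_neg (lt_irrefl i), add_zero, ← mul_pow]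
      simp
    · by_cases hj : j ∈ I.1
      · have hi' : i ∉ (I.erase ⟨j, hj⟩).1 := fun h => hi (Finset.mem_of_mem_erase h)
        have hj' : j ∈ (I.insert i hi).1 := Finset.mem_insert_of_mem hj
        rw [contract_e_of_mem hj', contract_e_of_mem hj, map_smul, wedge_e_of_notMem hi', smul_smul,
          smul_smul]
        have : (I.insert i hi).erase ⟨j, hj'⟩ = (I.erase ⟨j, hj⟩).insert i hi' :=
          Subtype.ext (Finset.erase_insert_of_ne hij)
        rw [this, ← add_smul, s_erase i hj]
        simp only [Index.insert, Index.erase]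
        rw [s_insert j hi, LinearMap.zero_apply]
        rcases lt_or_gt_of_ne hij with h | h
        · rw [if_neg h.asymm, if_pos h]
          convert zero_smul R _ using 2
          ring
        · rw [if_neg h.asymm, if_pos h]
          convert zero_smul R _ using 2
          ring
      · rw [contract_e_of_notMem hj, map_zero, add_zero, contract_e_of_notMem, smul_zero,
          LinearMap.zero_apply]
        simp [Index.insert, Ne.symm hij, hj]

theorem boundary_wedge_zero (x : Fin n → R) (i : Fin n) :
    boundary x 0 ∘ₗ wedge R i 0 = x i • LinearMap.id := by
  rw [boundary_eq_sum, linearMap_sum_comp]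
  simp only [LinearMap.smul_comp, contract_wedge_zero]
  simp

theorem boundary_wedge_succ (x : Fin n → R) (i : Fin n) (p : ℕ) :
    boundary x (p + 1) ∘ₗ wedge R i (p + 1) + wedge R i p ∘ₗ boundary x p =
      x i • LinearMap.id := by
  rw [boundary_eq_sum, boundary_eq_sum, linearMap_sum_comp, linearMap_comp_sum,
    ← Finset.sum_add_distrib]
  simp only [LinearMap.smul_comp, LinearMap.comp_smul, ← smul_add, contract_wedge_succ]
  simp

/-- Multiplication by an element of the ideal `(x₁, …, xₙ)` is null-homotopic on the Koszul
complex. -/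
theorem exists_homotopy (x : Fin n → R) {a : R} (ha : a ∈ Ideal.span (Set.range x)) :
    ∃ t : ∀ p, K R n p →ₗ[R] K R n (p + 1), boundary x 0 ∘ₗ t 0 = a • LinearMap.id ∧
      ∀ p, boundary x (p + 1) ∘ₗ t (p + 1) + t p ∘ₗ boundary x p = a • LinearMap.id := by
  obtain ⟨c, rfl⟩ := (Ideal.mem_span_range_iff_exists_fun).1 ha
  refine ⟨fun p => ∑ i, c i • wedge R i p, ?_, fun p => ?_⟩
  · simp only [linearMap_comp_sum, LinearMap.comp_smul, boundary_wedge_zero, Finset.sum_smul,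
      smul_smul]
  · simp only [linearMap_comp_sum, LinearMap.comp_smul, linearMap_sum_comp, LinearMap.smul_comp,
      ← Finset.sum_add_distrib, ← smul_add, boundary_wedge_succ, Finset.sum_smul, smul_smul]

end Koszul

/-! ### Vanishing of Koszul homology and cohomology -/

namespace Koszul

open RingTheory.Sequence

open scoped Pointwise

variable {R : Type u} [CommRing R] {n : ℕ}

/-- A map from `K_p` lifts along any map whose range contains the images of the basis vectors. -/
theorem K_exists_lift {A : Type v} {B : Type w} [AddCommGroup A] [Module R A] [AddCommGroup B]
    [Module R B] {p : ℕ} (f : K R n p →ₗ[R] B) (g : A →ₗ[R] B)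
    (h : ∀ I, f (e R I) ∈ LinearMap.range g) : ∃ f' : K R n p →ₗ[R] A, g ∘ₗ f' = f := by
  choose a ha using h
  refine ⟨Finsupp.linearCombination R a, K_hom_ext fun I => ?_⟩
  rw [LinearMap.comp_apply, e, Finsupp.linearCombination_single, one_smul, ha, e]

theorem K_exists_eq_smul {N : Type v} [AddCommGroup N] [Module R N] {p : ℕ} {y : R}
    (f : K R n p →ₗ[R] N) (h : (y • (⊤ : Submodule R N)).mkQ ∘ₗ f = 0) :
    ∃ f' : K R n p →ₗ[R] N, f = y • f' := by
  obtain ⟨f', hf'⟩ := K_exists_lift f (LinearMap.lsmul R N y) fun I => by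
    have := LinearMap.congr_fun h (e R I)
    rw [LinearMap.comp_apply, LinearMap.zero_apply, Submodule.mkQ_apply,
      Submodule.Quotient.mk_eq_zero, Submodule.mem_smul_pointwise_iff_exists] at this
    obtain ⟨b, -, hb⟩ := this
    exact ⟨b, hb⟩
  exact ⟨f', hf'.symm⟩

/-- Some power of `y` lies in the ideal, so the homotopy shows that this power kills the cocycle
`c`; regularity of `y` then forces `c = 0`. -/
theorem eq_zero_of_comp_boundary_eq_zero_of_isSMulRegular (x : Fin n → R) {N : Type v}
    [AddCommGroup N] [Module R N] {y : R} (hy : y ∈ (Ideal.span (Set.range x)).radical)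
    (hreg : IsSMulRegular N y) (c : K R n 0 →ₗ[R] N) (hc : c ∘ₗ boundary x 0 = 0) : c = 0 := by
  obtain ⟨m, hm⟩ := hy
  obtain ⟨t, ht, -⟩ := exists_homotopy x hm
  refine K_hom_ext fun I => hreg.pow m ?_
  have : y ^ m • c = 0 := by
    rw [← LinearMap.comp_id c, ← LinearMap.comp_smul, ← ht, ← LinearMap.comp_assoc, hc,
      LinearMap.zero_comp]
  simpa using LinearMap.congr_fun this (e R I)

theorem smul_injective_of_isSMulRegular {M : Type v} {N : Type w} [AddCommGroup M] [Module R M]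
    [AddCommGroup N] [Module R N] {y : R} (hreg : IsSMulRegular N y) {f g : M →ₗ[R] N}
    (h : y • f = y • g) : f = g :=
  LinearMap.ext fun m => hreg (LinearMap.congr_fun h m)

/-- The Koszul cohomology of a module with a weakly regular sequence of length `r` in the radical of
`(x₁, …, xₙ)` vanishes in degrees less than `r`. -/
theorem cocycle_of_isWeaklyRegular (x : Fin n → R) (rs : List R) :
    ∀ {N : Type v} [AddCommGroup N] [Module R N], IsWeaklyRegular N rs →
      (∀ r ∈ rs, r ∈ (Ideal.span (Set.range x)).radical) →
      (0 < rs.length → ∀ c : K R n 0 →ₗ[R] N, c ∘ₗ boundary x 0 = 0 → c = 0) ∧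
      ∀ p, p + 1 < rs.length → ∀ c : K R n (p + 1) →ₗ[R] N, c ∘ₗ boundary x (p + 1) = 0 →
        ∃ h : K R n p →ₗ[R] N, c = h ∘ₗ boundary x p := by
  induction rs with
  | nil => intro N _ _ _ _; simp
  | cons y rs ih =>
    intro N _ _ hN hrs
    rw [isWeaklyRegular_cons_iff] at hN
    obtain ⟨hy, hN'⟩ := hN
    have hyQ := hrs y (by simp)
    obtain ⟨ih0, ih1⟩ := ih hN' fun r hr => hrs r (by simp [hr])
    refine ⟨fun _ => eq_zero_of_comp_boundary_eq_zero_of_isSMulRegular x hyQ hy, fun p hp => ?_⟩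
    rw [List.length_cons] at hp
    -- The class of a cocycle vanishes as soon as `y` times it does: this is the long exact
    -- cohomology sequence of `0 → N → N → N/yN → 0`, done by hand.
    have step : ∀ c : K R n (p + 1) →ₗ[R] N, c ∘ₗ boundary x (p + 1) = 0 →
        (∃ h : K R n p →ₗ[R] N, y • c = h ∘ₗ boundary x p) →
        ∃ h : K R n p →ₗ[R] N, c = h ∘ₗ boundary x p := by
      rintro c hc ⟨h, hh⟩
      have hbar : ((y • (⊤ : Submodule R N)).mkQ ∘ₗ h) ∘ₗ boundary x p = 0 := by
        rw [LinearMap.comp_assoc, ← hh]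
        ext1 I
        ext
        simp only [LinearMap.comp_apply, LinearMap.smul_apply, Submodule.mkQ_apply,
          LinearMap.zero_apply, Submodule.Quotient.mk_eq_zero]
        exact Submodule.smul_mem_pointwise_smul _ _ _ trivial
      -- Modulo `y` the cochain `h` is a cocycle of lower degree, so by induction it is the
      -- reduction of a coboundary `g` (zero when `p = 0`). Then `h - g` is divisible by `y`, and
      -- `y` can be cancelled from `y • c = (h - g) ∘ ∂`.
      have key : ∃ g : K R n p →ₗ[R] N, g ∘ₗ boundary x p = 0 ∧
          (y • (⊤ : Submodule R N)).mkQ ∘ₗ (h - g) = 0 := by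
        cases p with
        | zero => exact ⟨0, LinearMap.zero_comp _, by rw [sub_zero]; exact ih0 (by omega) _ hbar⟩
        | succ q =>
          obtain ⟨gbar, hg⟩ := ih1 q (by omega) _ hbar
          obtain ⟨g, rfl⟩ := K_exists_lift gbar (y • (⊤ : Submodule R N)).mkQ fun I => by
            rw [Submodule.range_mkQ]
            trivial
          refine ⟨g ∘ₗ boundary x q, ?_, ?_⟩
          · rw [LinearMap.comp_assoc, boundary_comp_boundary, LinearMap.comp_zero]
          · rw [LinearMap.comp_sub, hg, LinearMap.comp_assoc, sub_self]
      obtain ⟨g, hg0, hg⟩ := key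
      obtain ⟨h', hh'⟩ := K_exists_eq_smul _ hg
      refine ⟨h', smul_injective_of_isSMulRegular hy ?_⟩
      rw [hh, ← LinearMap.smul_comp, ← hh', LinearMap.sub_comp, hg0, sub_zero]
    intro c hc
    obtain ⟨m, hm⟩ := hyQ
    obtain ⟨t, -, ht⟩ := exists_homotopy x hm
    -- A power of `y` lies in the ideal and so kills cohomology; `step` removes the factors `y` one
    -- at a time.
    have hcm : ∃ h : K R n p →ₗ[R] N, y ^ m • c = h ∘ₗ boundary x p := by
      refine ⟨c ∘ₗ t p, ?_⟩
      rw [← LinearMap.comp_id c, ← LinearMap.comp_smul, ← ht p, LinearMap.comp_add,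
        ← LinearMap.comp_assoc, hc, LinearMap.zero_comp, zero_add, LinearMap.comp_id,
        LinearMap.comp_assoc]
    clear ht t hm
    induction m with
    | zero => simpa using hcm
    | succ m ihm =>
      refine ihm (step _ ?_ ?_)
      · rw [LinearMap.smul_comp, hc, smul_zero]
      · rwa [smul_smul, ← pow_succ']

theorem lTensor_boundary_boundary (x : Fin n → R) (N : Type v) [AddCommGroup N] [Module R N]
    (p : ℕ) (z : N ⊗[R] K R n (p + 2)) :
    LinearMap.lTensor N (boundary x p) (LinearMap.lTensor N (boundary x (p + 1)) z) = 0 := by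
  rw [← LinearMap.lTensor_comp_apply, boundary_comp_boundary, LinearMap.lTensor_zero,
    LinearMap.zero_apply]

theorem rTensor_lTensor_apply {A B C D : Type*} [AddCommGroup A] [Module R A] [AddCommGroup B]
    [Module R B] [AddCommGroup C] [Module R C] [AddCommGroup D] [Module R D] (f : A →ₗ[R] B)
    (g : C →ₗ[R] D) (z : A ⊗[R] C) :
    LinearMap.rTensor D f (LinearMap.lTensor A g z) =
      LinearMap.lTensor B g (LinearMap.rTensor C f z) := by
  rw [← LinearMap.comp_apply, ← LinearMap.comp_apply, LinearMap.rTensor_comp_lTensor,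
    LinearMap.lTensor_comp_rTensor]

/-- The Koszul homology of a module with a weakly regular sequence of length `r` in the radical of
`(x₁, …, xₙ)` vanishes in positive degrees greater than `n - r`. -/
theorem cycle_of_isWeaklyRegular (x : Fin n → R) (rs : List R) :
    ∀ {N : Type v} [AddCommGroup N] [Module R N], IsWeaklyRegular N rs →
      (∀ r ∈ rs, r ∈ (Ideal.span (Set.range x)).radical) →
      ∀ p, n < p + 1 + rs.length → ∀ z : N ⊗[R] K R n (p + 1),
        LinearMap.lTensor N (boundary x p) z = 0 →
        ∃ w, LinearMap.lTensor N (boundary x (p + 1)) w = z := by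
  induction rs with
  | nil =>
    intro N _ _ _ _ p hp z hz
    clear hz
    have : Subsingleton (K R n (p + 1)) := K_subsingleton (by simpa using hp)
    have hz : z = 0 := by
      induction z using TensorProduct.induction_on with
      | zero => rfl
      | tmul a b => rw [Subsingleton.elim b 0, TensorProduct.tmul_zero]
      | add a b ha hb => simp_all
    exact ⟨0, by rw [map_zero, hz]⟩
  | cons y rs ih =>
    intro N _ _ hN hrs p hp
    rw [isWeaklyRegular_cons_iff] at hN
    obtain ⟨hy, hN'⟩ := hN
    have hyQ := hrs y (by simp)
    -- Raising the degree by one compensates for the sequence being one shorter on `N/yN`.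
    have ih' := ih hN' (fun r hr => hrs r (by simp [hr])) (p + 1)
      (by rw [List.length_cons] at hp; omega)
    have hex : Function.Exact (LinearMap.lsmul R N y) (y • (⊤ : Submodule R N)).mkQ := by
      intro b
      rw [Submodule.mkQ_apply, Submodule.Quotient.mk_eq_zero,
        Submodule.mem_smul_pointwise_iff_exists]
      simp
    have hker : ∀ q, ∀ w : N ⊗[R] K R n q,
        LinearMap.rTensor _ (y • (⊤ : Submodule R N)).mkQ w = 0 → ∃ w', w = y • w' := by
      intro q w hw
      obtain ⟨w', hw'⟩ := (rTensor_exact (K R n q) hex (Submodule.mkQ_surjective _) w).1 hw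
      refine ⟨w', hw'.symm.trans ?_⟩
      have : LinearMap.lsmul R N y = y • LinearMap.id := by ext; simp
      rw [this, LinearMap.rTensor_smul, LinearMap.rTensor_id, LinearMap.smul_apply,
        LinearMap.id_apply]
    have step : ∀ z : N ⊗[R] K R n (p + 1),
        (∃ w, LinearMap.lTensor N (boundary x (p + 1)) w = y • z) →
        ∃ w, LinearMap.lTensor N (boundary x (p + 1)) w = z := by
      rintro z ⟨w, hw⟩
      -- If `∂w = y • z`, then `w` is a cycle modulo `y`, hence a boundary there. Lifting gives `w =
      -- ∂g + y • w'`, so `y • ∂w' = y • z`, and `y` is regular on `N ⊗ K_{p+1}` because `K_{p+1}`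
      -- is flat.
      obtain ⟨gbar, hg⟩ := ih' (LinearMap.rTensor _ (y • (⊤ : Submodule R N)).mkQ w) (by
        rw [← rTensor_lTensor_apply, hw, map_smul]
        generalize LinearMap.rTensor _ (y • (⊤ : Submodule R N)).mkQ z = a
        induction a using TensorProduct.induction_on with
        | zero => rw [smul_zero]
        | tmul a b =>
          rw [TensorProduct.smul_tmul']
          obtain ⟨a, rfl⟩ := Submodule.mkQ_surjective _ a
          have ha : y • a ∈ y • (⊤ : Submodule R N) :=
            Submodule.smul_mem_pointwise_smul _ _ _ trivial
          rw [← map_smul, Submodule.mkQ_apply, (Submodule.Quotient.mk_eq_zero _).2 ha,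
            TensorProduct.zero_tmul]
        | add a b ha hb => rw [smul_add, ha, hb, add_zero])
      obtain ⟨g, rfl⟩ := LinearMap.rTensor_surjective (K R n (p + 1 + 1 + 1))
        (Submodule.mkQ_surjective (y • (⊤ : Submodule R N))) gbar
      obtain ⟨w', hw'⟩ := hker _ (w - LinearMap.lTensor N (boundary x (p + 1 + 1)) g) (by
        rw [map_sub, rTensor_lTensor_apply, hg, sub_self])
      refine ⟨w', IsSMulRegular.rTensor (K R n (p + 1)) hy ?_⟩
      change y • _ = y • _
      rw [← map_smul, ← hw', map_sub, hw, lTensor_boundary_boundary, sub_zero]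
    intro z hz
    obtain ⟨m, hm⟩ := hyQ
    obtain ⟨t, -, ht⟩ := exists_homotopy x hm
    have hzm : ∃ w, LinearMap.lTensor N (boundary x (p + 1)) w = y ^ m • z := by
      refine ⟨LinearMap.lTensor N (t (p + 1)) z, ?_⟩
      have := LinearMap.congr_fun (congrArg (LinearMap.lTensor N) (ht p)) z
      rw [LinearMap.lTensor_add, LinearMap.add_apply, LinearMap.lTensor_comp_apply,
        LinearMap.lTensor_comp_apply, hz, map_zero, add_zero, LinearMap.lTensor_smul,
        LinearMap.lTensor_id] at this
      exact this
    clear ht t hm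
    induction m with
    | zero => simpa using hzm
    | succ m ihm => exact ihm (step _ (by rwa [smul_smul, ← pow_succ']))

theorem isWeaklyRegular_of_flat {rs : List R} (h : IsWeaklyRegular R rs) (N : Type v)
    [AddCommGroup N] [Module R N] [Module.Flat R N] : IsWeaklyRegular N rs :=
  ((TensorProduct.rid R N).isWeaklyRegular_congr rs).1 h.isWeaklyRegular_lTensor

/-- A sequence of length at least `n` in the radical of `(x₁, …, xₙ)` which is weakly regular
on `R`. -/
def HasDepth (x : Fin n → R) : Prop :=
  ∃ rs : List R, n ≤ rs.length ∧ (∀ r ∈ rs, r ∈ (Ideal.span (Set.range x)).radical) ∧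
    IsWeaklyRegular R rs

variable {x : Fin n → R}

theorem HasDepth.cocycle_zero (hx : HasDepth x) (hn : 0 < n) {N : Type v} [AddCommGroup N]
    [Module R N] [Module.Flat R N] {c : K R n 0 →ₗ[R] N} (hc : c ∘ₗ boundary x 0 = 0) : c = 0 :=
  let ⟨rs, hl, hr, h⟩ := hx
  (cocycle_of_isWeaklyRegular x rs (isWeaklyRegular_of_flat h N) hr).1 (by omega) c hc

theorem HasDepth.cocycle_succ (hx : HasDepth x) {p : ℕ} (hn : p + 1 < n) {N : Type v}
    [AddCommGroup N] [Module R N] [Module.Flat R N] {c : K R n (p + 1) →ₗ[R] N}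
    (hc : c ∘ₗ boundary x (p + 1) = 0) : ∃ h : K R n p →ₗ[R] N, c = h ∘ₗ boundary x p :=
  let ⟨rs, hl, hr, h⟩ := hx
  (cocycle_of_isWeaklyRegular x rs (isWeaklyRegular_of_flat h N) hr).2 p (by omega) c hc

theorem HasDepth.cycle (hx : HasDepth x) (p : ℕ) {N : Type v} [AddCommGroup N] [Module R N]
    [Module.Flat R N] {z : N ⊗[R] K R n (p + 1)} (hz : LinearMap.lTensor N (boundary x p) z = 0) :
    ∃ w, LinearMap.lTensor N (boundary x (p + 1)) w = z :=
  let ⟨rs, hl, hr, h⟩ := hx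
  cycle_of_isWeaklyRegular x rs (isWeaklyRegular_of_flat h N) hr p (by omega) z hz

end Koszul

/-- The Koszul arguments only need some regular sequence of length at least `n` in the radical of
`Q`, here the maximal ideal. The equality of depth and dimension supplies one, so `x` itself need
not be shown to be regular. -/
theorem Koszul.hasDepth_of_isSystemOfParameters {R : Type u} [CommRing R] [IsLocalRing R]
    (hR : IsCohenMacaulayLocal R) {n : ℕ} {x : Fin n → R} (hx : IsSystemOfParameters x) :
    Koszul.HasDepth x := by
  have hd : moduleDepth R R = n := by
    have := hR.depth_eq_dim.trans hx.dim_eq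
    exact_mod_cast this
  cases n with
  | zero => exact ⟨[], le_rfl, by simp, RingTheory.Sequence.IsWeaklyRegular.nil R R⟩
  | succ m =>
    -- A supremum in `ℕ∞` is not attained by definition; a strict lower bound `m = n - 1` already
    -- yields a sequence of length at least `n`.
    have hlt : (m : ℕ∞) < moduleDepth R R := by
      rw [hd]
      exact_mod_cast Nat.lt_succ_self m
    unfold moduleDepth at hlt
    rw [lt_iSup_iff] at hlt
    obtain ⟨rs, hrs⟩ := hlt
    rw [lt_iSup_iff] at hrs
    obtain ⟨⟨hm, hreg⟩, hlen⟩ := hrs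
    refine ⟨rs, ?_, ?_, hreg⟩
    · have : m < rs.length := by exact_mod_cast hlen
      omega
    · rwa [hx.radical_eq]

/-! ### Chain maps from the Koszul complex -/

namespace Koszul

variable {R : Type u} [CommRing R]

theorem s_univ {n : ℕ} (i : Fin n) : s i Finset.univ = i := by
  have : Finset.univ.filter (fun j : Fin n => j < i) = Finset.Iio i := by ext; simp
  rw [s, this, Fin.card_Iio]

theorem eq_full {n : ℕ} (I : Index n n) : I = Index.full n :=
  Subtype.ext (Finset.card_eq_iff_eq_univ _ |>.1 (by rw [I.2, Fintype.card_fin]))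

theorem eq_of_index_zero {n : ℕ} (I J : Index n 0) : I = J :=
  Subtype.ext ((Finset.card_eq_zero.1 I.2).trans (Finset.card_eq_zero.1 J.2).symm)

theorem compl_bijective (m : ℕ) :
    Function.Bijective (Index.compl : Fin (m + 1) → Index (m + 1) m) := by
  constructor
  · intro i j hij
    by_contra hne
    have : i ∈ (Index.compl j).1 := Finset.mem_erase.2 ⟨hne, Finset.mem_univ i⟩
    rw [← hij] at this
    exact Finset.notMem_erase _ _ this
  · intro I
    have hc : I.1ᶜ.card = 1 := by
      rw [Finset.card_compl, I.2, Fintype.card_fin]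
      omega
    obtain ⟨i, hi⟩ := Finset.card_eq_one.1 hc
    refine ⟨i, Subtype.ext ?_⟩
    rw [← compl_compl I.1, hi]
    ext j
    simp [Index.compl]

theorem boundary_full {m : ℕ} (x : Fin (m + 1) → R) :
    boundary x m (e R (Index.full (m + 1))) =
      ∑ i : Fin (m + 1), ((-1) ^ (i : ℕ) * x i) • e R (Index.compl i) := by
  rw [boundary_eq_sum, LinearMap.sum_apply]
  refine Finset.sum_congr rfl fun i _ => ?_
  have hi : i ∈ (Index.full (m + 1)).1 := Finset.mem_univ i
  rw [LinearMap.smul_apply, contract_e_of_mem hi, smul_smul, mul_comm]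
  congr 2
  rw [Index.full, s_univ]

theorem exists_hom_compl {N : Type v} [AddCommGroup N] [Module R N] {m : ℕ}
    (y : Fin (m + 1) → N) :
    ∃ h : K R (m + 1) m →ₗ[R] N, ∀ i, h (e R (Index.compl i)) = y i := by
  let E := Equiv.ofBijective _ (compl_bijective m)
  refine ⟨Finsupp.linearCombination R fun I => y (E.symm I), fun i => ?_⟩
  rw [e, Finsupp.linearCombination_single, one_smul]
  exact congrArg y (E.symm_apply_apply i)

/-- Half of the identification of `H_0(G ⊗ K_•)` with `G/QG`. -/
theorem range_boundary_zero {n : ℕ} (x : Fin n → R) (G : Type v) [AddCommGroup G] [Module R G]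
    (y : Fin n → G) (I : Index n 0) :
    (∑ i, x i • y i) ⊗ₜ[R] e R I ∈ LinearMap.range (LinearMap.lTensor G (boundary x 0)) := by
  rw [TensorProduct.sum_tmul]
  refine Submodule.sum_mem _ fun i _ => ⟨y i ⊗ₜ wedge R i 0 (e R I), ?_⟩
  rw [LinearMap.lTensor_tmul, ← LinearMap.comp_apply, boundary_wedge_zero,
    LinearMap.smul_apply, LinearMap.id_apply, TensorProduct.tmul_smul, TensorProduct.smul_tmul']

section ChainMap

variable {m : ℕ} {x : Fin (m + 1) → R} {F : ℕ → Type v} [∀ p, AddCommGroup (F p)]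
  [∀ p, Module R (F p)] {φ : ∀ p, F (p + 1) →ₗ[R] F p}

/-- A chain map from the Koszul complex into an acyclic complex which vanishes in degree `0` up to
a boundary takes its top value in `QF_n`. -/
theorem top_mem_of_zero_mem (hex : ∀ p, Function.Exact (φ (p + 1)) (φ p))
    (hvan : Subsingleton (F (m + 2))) {ρ : ∀ p, K R (m + 1) p →ₗ[R] F p}
    (hρ : ∀ p, φ p ∘ₗ ρ (p + 1) = ρ p ∘ₗ boundary x p)
    (h0 : ∀ I, ρ 0 (e R I) ∈ LinearMap.range (φ 0)) :
    ∃ y : Fin (m + 1) → F (m + 1), ρ (m + 1) (e R (Index.full (m + 1))) = ∑ i, x i • y i := by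
  have lift : ∀ p (h : K R (m + 1) p →ₗ[R] F (p + 1)),
      φ p ∘ₗ (ρ (p + 1) - h ∘ₗ boundary x p) = 0 →
      ∃ h' : K R (m + 1) (p + 1) →ₗ[R] F (p + 2),
        ρ (p + 1) = φ (p + 1) ∘ₗ h' + h ∘ₗ boundary x p := by
    intro p h hh
    obtain ⟨h', hh'⟩ := K_exists_lift (ρ (p + 1) - h ∘ₗ boundary x p) (φ (p + 1)) fun I =>
      (hex p _).1 (LinearMap.congr_fun hh (e R I))
    exact ⟨h', by rw [hh', sub_add_cancel]⟩
  -- Null-homotopy of `ρ` built upward: the defect of each stage is a cycle, hence lifts through the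
  -- next differential.
  have key : ∀ p, ∃ (h : K R (m + 1) p →ₗ[R] F (p + 1))
      (h' : K R (m + 1) (p + 1) →ₗ[R] F (p + 2)),
      ρ (p + 1) = φ (p + 1) ∘ₗ h' + h ∘ₗ boundary x p := by
    intro p
    induction p with
    | zero =>
      obtain ⟨h, hh⟩ := K_exists_lift (ρ 0) (φ 0) h0
      refine ⟨h, lift 0 h ?_⟩
      rw [LinearMap.comp_sub, hρ, ← LinearMap.comp_assoc, hh, sub_self]
    | succ p ih =>
      obtain ⟨h, h', hh⟩ := ih
      refine ⟨h', lift (p + 1) h' ?_⟩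
      rw [LinearMap.comp_sub, hρ, hh, LinearMap.add_comp, LinearMap.comp_assoc _ _ h,
        boundary_comp_boundary, LinearMap.comp_zero, add_zero, LinearMap.comp_assoc, sub_self]
  obtain ⟨h, h', hh⟩ := key m
  refine ⟨fun i => (-1 : R) ^ (i : ℕ) • h (e R (Index.compl i)), ?_⟩
  rw [hh, LinearMap.add_apply, LinearMap.comp_apply, Subsingleton.elim (h' _) 0, map_zero, zero_add,
    LinearMap.comp_apply, boundary_full, map_sum]
  refine Finset.sum_congr rfl fun i _ => ?_
  rw [map_smul, smul_smul, mul_comm]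

/-- A chain map from the Koszul complex to a complex of flat modules with top value in `QF_n` is
a boundary in degree `0`. -/
theorem zero_mem_of_top_mem (hx : HasDepth x) [∀ p, Module.Flat R (F p)]
    (hcx : ∀ p, φ p ∘ₗ φ (p + 1) = 0)
    {ρ : ∀ p, K R (m + 1) p →ₗ[R] F p}
    (hρ : ∀ p, φ p ∘ₗ ρ (p + 1) = ρ p ∘ₗ boundary x p) {y : Fin (m + 1) → F (m + 1)}
    (hy : ρ (m + 1) (e R (Index.full (m + 1))) = ∑ i, x i • y i) (I : Index (m + 1) 0) :
    ρ 0 (e R I) ∈ LinearMap.range (φ 0) := by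
  have hc : ∀ p (h : K R (m + 1) p →ₗ[R] F (p + 1)) (h' : K R (m + 1) (p + 1) →ₗ[R] F (p + 2)),
      ρ (p + 1) = φ (p + 1) ∘ₗ h' + h ∘ₗ boundary x p →
      (ρ p - φ p ∘ₗ h) ∘ₗ boundary x p = 0 := by
    intro p h h' hh
    rw [LinearMap.sub_comp, ← hρ, hh, LinearMap.comp_add, ← LinearMap.comp_assoc, hcx,
      LinearMap.zero_comp, zero_add, LinearMap.comp_assoc, sub_self]
  -- The homotopy is built downward from degree `n`, where `y` prescribes `h` and `h' = 0`. Each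
  -- defect `ρ_p - φ_p ∘ h` is a Koszul cocycle of degree below `n`, hence a coboundary; in degree
  -- `0` it is zero.
  have key : ∀ d p, p + d = m → ∃ (h : K R (m + 1) p →ₗ[R] F (p + 1))
      (h' : K R (m + 1) (p + 1) →ₗ[R] F (p + 2)),
      ρ (p + 1) = φ (p + 1) ∘ₗ h' + h ∘ₗ boundary x p := by
    intro d
    induction d with
    | zero =>
      intro p hp
      obtain rfl : m = p := hp.symm
      obtain ⟨h, hh⟩ := exists_hom_compl (R := R) fun i : Fin (m + 1) => (-1 : R) ^ (i : ℕ) • y i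
      refine ⟨h, 0, K_hom_ext fun J => ?_⟩
      rw [eq_full J, LinearMap.comp_zero, zero_add, LinearMap.comp_apply]
      refine hy.trans (Eq.trans ?_ (congrArg h (boundary_full x)).symm)
      rw [map_sum]
      refine Finset.sum_congr rfl fun i _ => ?_
      rw [map_smul, hh, smul_smul, mul_right_comm, ← mul_pow]
      simp
    | succ d ih =>
      intro p hp
      obtain ⟨h, h', hh⟩ := ih (p + 1) (by omega)
      obtain ⟨g, hg⟩ := hx.cocycle_succ (by omega) (hc (p + 1) h h' hh)
      exact ⟨g, h, by rw [← hg, add_sub_cancel]⟩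
  obtain ⟨h, h', hh⟩ := key m 0 (Nat.zero_add m)
  have h0 := sub_eq_zero.1 (hx.cocycle_zero m.succ_pos (hc 0 h h' hh))
  exact ⟨h (e R I), (LinearMap.congr_fun h0 (e R I)).symm⟩

/-- Every element of `M :_{F₀} Q` lifts to a chain map from the Koszul complex. -/
theorem exists_chainMap_of_mem_moduleColon (hex : ∀ p, Function.Exact (φ (p + 1)) (φ p)) {z : F 0}
    (hz : z ∈ moduleColon (LinearMap.range (φ 0)) (Ideal.span (Set.range x))) :
    ∃ τ : ∀ p, K R (m + 1) p →ₗ[R] F p, (∀ I, τ 0 (e R I) = z) ∧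
      ∀ p, φ p ∘ₗ τ (p + 1) = τ p ∘ₗ boundary x p := by
  have key : ∀ j, ∃ τ : ∀ p, K R (m + 1) p →ₗ[R] F p, (∀ I, τ 0 (e R I) = z) ∧
      ∀ p < j, φ p ∘ₗ τ (p + 1) = τ p ∘ₗ boundary x p := by
    intro j
    induction j with
    | zero =>
      -- Components not yet constructed are set to zero; stage `j` constrains only the squares below
      -- `j`.
      refine ⟨fun p => match p with
        | 0 => Finsupp.linearCombination R fun _ => z
        | _ + 1 => 0, fun I => ?_, fun p hp => absurd hp (Nat.not_lt_zero p)⟩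
      simp [e]
    | succ j ih =>
      obtain ⟨τ, h0, hτ⟩ := ih
      have hr : ∀ I, (τ j ∘ₗ boundary x j) (e R I) ∈ LinearMap.range (φ j) := by
        intro I
        cases j with
        | zero =>
          rw [LinearMap.comp_apply, boundary_e, map_sum]
          refine Submodule.sum_mem _ fun i _ => ?_
          rw [map_smul, h0]
          exact hz _ (Ideal.mul_mem_left _ _ (Ideal.subset_span ⟨i, rfl⟩))
        | succ j =>
          refine (hex j _).1 ?_
          rw [← LinearMap.comp_apply, ← LinearMap.comp_assoc, hτ j (Nat.lt_succ_self j),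
            LinearMap.comp_assoc, boundary_comp_boundary, LinearMap.comp_zero,
            LinearMap.zero_apply]
      obtain ⟨f, hf⟩ := K_exists_lift _ _ hr
      refine ⟨Function.update τ (j + 1) f, ?_, fun p hp => ?_⟩
      · rwa [Function.update_of_ne (by omega)]
      · rw [Function.update_of_ne (show p ≠ j + 1 by omega)]
        rcases Nat.lt_succ_iff_lt_or_eq.1 hp with h | rfl
        · rw [Function.update_of_ne (by omega), hτ p h]
        · rw [Function.update_self, hf]
  obtain ⟨τ, h0, hτ⟩ := key (m + 1)
  refine ⟨τ, h0, fun p => ?_⟩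
  rcases Nat.lt_or_ge p (m + 1) with h | h
  · exact hτ p h
  · have := K_subsingleton (R := R) (Nat.lt_succ_of_le h)
    exact LinearMap.ext fun a => by rw [Subsingleton.elim a 0, map_zero, map_zero]

/-- If the complex has length less than `n`, then `M :_{F₀} Q = M`. -/
theorem moduleColon_range_le (hx : HasDepth x) [∀ p, Module.Flat R (F p)]
    (hex : ∀ p, Function.Exact (φ (p + 1)) (φ p)) (hvan : Subsingleton (F (m + 1))) :
    moduleColon (LinearMap.range (φ 0)) (Ideal.span (Set.range x)) ≤ LinearMap.range (φ 0) := by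
  intro z hz
  obtain ⟨τ, h0, hτ⟩ := exists_chainMap_of_mem_moduleColon hex hz
  obtain ⟨I, -⟩ : ∃ I : Index (m + 1) 0, True := ⟨⟨∅, rfl⟩, trivial⟩
  rw [← h0 I]
  -- The top value lies in `F_n = 0`, so `y = 0` serves.
  exact zero_mem_of_top_mem hx (fun p => (hex p).linearMap_comp_eq_zero) hτ (y := 0)
    (Subsingleton.elim _ _) I

/-- A chain map from the Koszul complex is determined by compatible values in the two top
degrees. -/
theorem exists_chainMap_of_top (hx : HasDepth x) [∀ p, Module.Flat R (F p)]
    (hcx : ∀ p, φ p ∘ₗ φ (p + 1) = 0) (a : F (m + 1)) (y : Fin (m + 1) → F m)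
    (ha : φ m a = ∑ i : Fin (m + 1), ((-1) ^ (i : ℕ) * x i) • y i) :
    ∃ τ : ∀ p, K R (m + 1) p →ₗ[R] F p, τ (m + 1) (e R (Index.full (m + 1))) = a ∧
      (∀ i, τ m (e R (Index.compl i)) = y i) ∧ ∀ p, φ p ∘ₗ τ (p + 1) = τ p ∘ₗ boundary x p := by
  have key : ∀ d j, j + d = m → ∃ τ : ∀ p, K R (m + 1) p →ₗ[R] F p,
      τ (m + 1) (e R (Index.full (m + 1))) = a ∧ (∀ i, τ m (e R (Index.compl i)) = y i) ∧
      ∀ p, j ≤ p → φ p ∘ₗ τ (p + 1) = τ p ∘ₗ boundary x p := by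
    intro d
    induction d with
    | zero =>
      intro j hj
      obtain rfl : m = j := hj.symm
      obtain ⟨h, hh⟩ := exists_hom_compl (R := R) y
      have hm : ∃ f : K R (m + 1) (m + 1) →ₗ[R] F (m + 1), ∀ I, f (e R I) = a :=
        ⟨Finsupp.linearCombination R fun _ => a, fun I => by simp [e]⟩
      obtain ⟨f, hf⟩ := hm
      refine ⟨Function.update (Function.update 0 m h) (m + 1) f, ?_, ?_, fun p hp => ?_⟩
      · rw [Function.update_self, hf]
      · rwa [Function.update_of_ne (by omega), Function.update_self]
      · rcases hp.eq_or_lt with rfl | h'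
        · rw [Function.update_self, Function.update_of_ne (by omega), Function.update_self]
          refine K_hom_ext fun I => ?_
          rw [LinearMap.comp_apply, hf, ha, eq_full I, LinearMap.comp_apply, boundary_full, map_sum]
          refine Finset.sum_congr rfl fun i _ => ?_
          rw [map_smul, hh]
        · have := K_subsingleton (R := R) (Nat.lt_succ_of_le h')
          exact LinearMap.ext fun a => by rw [Subsingleton.elim a 0, map_zero, map_zero]
    | succ d ih =>
      intro j hj
      obtain ⟨τ, h1, h2, hτ⟩ := ih (j + 1) (by omega)
      -- The next component down must factor `φ_j ∘ τ_{j+1}` through `∂`; being a cocycle of degree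
      -- `j + 1 < n`, that map is a coboundary.
      have hc : (φ j ∘ₗ τ (j + 1)) ∘ₗ boundary x (j + 1) = 0 := by
        rw [LinearMap.comp_assoc, ← hτ _ le_rfl, ← LinearMap.comp_assoc, hcx, LinearMap.zero_comp]
      obtain ⟨h, hh⟩ := hx.cocycle_succ (by omega) hc
      refine ⟨Function.update τ j h, ?_, ?_, fun p hp => ?_⟩
      · rwa [Function.update_of_ne (by omega)]
      · rwa [Function.update_of_ne (by omega)]
      · rw [Function.update_of_ne (show p + 1 ≠ j by omega)]
        rcases hp.eq_or_lt with rfl | h'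
        · rw [Function.update_self, hh]
        · rw [Function.update_of_ne (by omega), hτ p h']
  obtain ⟨τ, h1, h2, hτ⟩ := key m 0 (Nat.zero_add m)
  exact ⟨τ, h1, h2, fun p => hτ p p.zero_le⟩

end ChainMap

end Koszul

/-! ### The mapping cone of an admissible chain map -/

namespace StarTransform

open Koszul

section Cone

variable {R : Type u} [CommRing R] {n : ℕ} {G : Type u} [AddCommGroup G] [Module R G]
  {F : ℕ → Type u} [∀ p, AddCommGroup (F p)] [∀ p, Module R (F p)] (x : Fin n → R)
  (φ : ∀ p, F (p + 1) →ₗ[R] F p) (σ : ∀ p, G ⊗[R] K R n p →ₗ[R] F p)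

theorem coneMap_zero_apply (g : G ⊗[R] K R n 0) (f : F 1) :
    coneMap x φ σ 0 ((g, f) : (G ⊗[R] K R n 0) × F 1) = (σ 0 g + φ 0 f : F 0) := rfl

theorem coneMap_succ_apply (p : ℕ) (g : G ⊗[R] K R n (p + 1)) (f : F (p + 2)) :
    coneMap x φ σ (p + 1) ((g, f) : (G ⊗[R] K R n (p + 1)) × F (p + 2)) =
      ((LinearMap.lTensor G (boundary x p) g, (-1 : R) ^ (p + 1) • σ (p + 1) g + φ (p + 1) f) :
        (G ⊗[R] K R n p) × F (p + 1)) := rfl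

instance [Module.Free R G] [∀ p, Module.Free R (F p)] (p : ℕ) :
    Module.Free R (Cone R n G F p) :=
  match p with
  | 0 => inferInstanceAs (Module.Free R (F 0))
  | p + 1 => inferInstanceAs (Module.Free R ((G ⊗[R] K R n p) × F (p + 1)))

instance [Module.Finite R G] [∀ p, Module.Finite R (F p)] (p : ℕ) :
    Module.Finite R (Cone R n G F p) :=
  match p with
  | 0 => inferInstanceAs (Module.Finite R (F 0))
  | p + 1 => inferInstanceAs (Module.Finite R ((G ⊗[R] K R n p) × F (p + 1)))

variable {x φ σ}

theorem coneMap_coneMap (hcx : ∀ p, φ p ∘ₗ φ (p + 1) = 0)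
    (hσ : ∀ p, φ p ∘ₗ σ (p + 1) = σ p ∘ₗ LinearMap.lTensor G (boundary x p)) (p : ℕ)
    (z : Cone R n G F (p + 2)) : coneMap x φ σ p (coneMap x φ σ (p + 1) z) = 0 := by
  obtain ⟨g, f⟩ := (z : (G ⊗[R] K R n (p + 1)) × F (p + 2))
  have h1 := LinearMap.congr_fun (hσ p) g
  have h2 := LinearMap.congr_fun (hcx p) f
  simp only [LinearMap.comp_apply, LinearMap.zero_apply] at h1 h2
  rw [coneMap_succ_apply]
  cases p with
  | zero =>
    rw [coneMap_zero_apply, map_add, map_smul, h1, h2]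
    simp
    rfl
  | succ p =>
    rw [coneMap_succ_apply, lTensor_boundary_boundary, map_add, map_smul, h1, h2]
    refine Prod.ext rfl ?_
    change _ = (0 : F (p + 1))
    rw [add_zero, ← add_smul, pow_succ _ (p + 1)]
    simp

/-- The cone is exact in degrees at least `1` if the homology of `G ⊗ K_•` vanishes in degrees at
least `1` and injects into that of `F_•` in degree `0`. -/
theorem coneMap_exact (hex : ∀ p, Function.Exact (φ (p + 1)) (φ p))
    (hσ : ∀ p, φ p ∘ₗ σ (p + 1) = σ p ∘ₗ LinearMap.lTensor G (boundary x p))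
    (hK : ∀ p (z : G ⊗[R] K R n (p + 1)), LinearMap.lTensor G (boundary x p) z = 0 →
      ∃ w, LinearMap.lTensor G (boundary x (p + 1)) w = z)
    (h0 : ∀ g, σ 0 g ∈ LinearMap.range (φ 0) →
      g ∈ LinearMap.range (LinearMap.lTensor G (boundary x 0))) (p : ℕ) :
    Function.Exact (coneMap x φ σ (p + 1)) (coneMap x φ σ p) := by
  intro z
  constructor
  · intro hz
    obtain ⟨g, f⟩ := (z : (G ⊗[R] K R n p) × F (p + 1))
    -- The Koszul component of a cycle bounds: by injectivity on `H_0` in the lowest degree, by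
    -- acyclicity of `G ⊗ K_•` above it.
    have key : ∃ g', LinearMap.lTensor G (boundary x p) g' = g ∧
        φ p f = (-1 : R) ^ (p + 1) • σ p g := by
      cases p with
      | zero =>
        rw [coneMap_zero_apply] at hz
        have hz' : σ 0 g = φ 0 (-f) := by rw [map_neg]; exact eq_neg_of_add_eq_zero_left hz
        obtain ⟨g', hg'⟩ := h0 g ⟨-f, hz'.symm⟩
        refine ⟨g', hg', ?_⟩
        rw [hz']
        simp
      | succ p =>
        rw [coneMap_succ_apply] at hz
        obtain ⟨g', hg'⟩ := hK p g (congrArg Prod.fst hz)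
        refine ⟨g', hg', ?_⟩
        have h2 : (-1 : R) ^ (p + 1) • σ (p + 1) g + φ (p + 1) f = 0 := congrArg Prod.snd hz
        rw [eq_neg_of_add_eq_zero_right h2, pow_succ _ (p + 1)]
        simp
    obtain ⟨g', rfl, hf⟩ := key
    obtain ⟨f', hf'⟩ := (hex p (f - (-1 : R) ^ (p + 1) • σ (p + 1) g')).1 (by
      rw [map_sub, map_smul, hf, ← LinearMap.comp_apply, ← LinearMap.comp_apply, hσ, sub_self])
    refine ⟨((g', f') : (G ⊗[R] K R n (p + 1)) × F (p + 2)), ?_⟩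
    rw [coneMap_succ_apply, hf']
    exact Prod.ext rfl (add_sub_cancel _ _)
  · rintro ⟨w, rfl⟩
    exact coneMap_coneMap (fun p => (hex p).linearMap_comp_eq_zero) hσ p w

end Cone

section Transform

variable {R : Type u} [CommRing R] {k : ℕ} {F : ℕ → Type u} [∀ p, AddCommGroup (F p)]
  [∀ p, Module R (F p)] {Λ : Type w} {x : Fin (k + 2) → R} {φ : ∀ p, F (p + 1) →ₗ[R] F p}
  {b : Module.Basis Λ R (F (k + 2))} {v : Λ → Fin (k + 2) → F (k + 1)} {U : Set (F (k + 1))}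
  {σ : ∀ p, F (k + 2) ⊗[R] K R (k + 2) p →ₗ[R] F p}

theorem exists_isAdmissible (hx : HasDepth x) [∀ p, Module.Flat R (F p)]
    (hcx : ∀ p, φ p ∘ₗ φ (p + 1) = 0) (hv : ∀ l, φ (k + 1) (b l) = ∑ i, x i • v l i) :
    ∃ σ, IsAdmissible x φ b v σ := by
  -- One chain map for each basis vector. The admissible signs are compatible since `e_{N \ {i}}`
  -- carries `(-1)^i` in `∂ e_N` and `(-1)^i (-1)^(n+i) = (-1)^n`, with `i` counted from `0`.
  have h : ∀ l, _ := fun l => exists_chainMap_of_top hx hcx ((-1 : R) ^ (k + 2) • b l)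
    (fun i => (-1 : R) ^ (k + 2 + i.1) • v l i) (by
      rw [map_smul, hv, Finset.smul_sum]
      refine Finset.sum_congr rfl fun i _ => ?_
      rw [smul_smul, smul_smul]
      congr 1
      have h1 : (-1 : R) ^ (i : ℕ) * (-1) ^ (i : ℕ) = 1 := by rw [← mul_pow]; simp
      rw [pow_add _ (k + 2)]
      linear_combination -(-1) ^ (k + 2) * x i * h1)
  choose τ h1 h2 h3 using h
  have hb : ∀ p l z, TensorProduct.lift (b.constr R fun l => τ l p) (b l ⊗ₜ z) = τ l p z := by
    intro p l z
    rw [TensorProduct.lift.tmul, Module.Basis.constr_basis]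
  refine ⟨fun p => TensorProduct.lift (b.constr R fun l => τ l p), fun p => ?_, fun l i => ?_,
    fun l => ?_⟩
  · refine TensorProduct.ext (b.ext fun l => LinearMap.ext fun z => ?_)
    change φ p (TensorProduct.lift _ (b l ⊗ₜ z)) =
      TensorProduct.lift _ (b l ⊗ₜ boundary x p z)
    rw [hb, hb]
    exact LinearMap.congr_fun (h3 l p) z
  · exact (hb _ _ _).trans (h2 l i)
  · exact (hb _ _ _).trans (h1 l)

/-- The chain map from the Koszul complex given by an element of `F_n`. -/
theorem IsAdmissible.comm_mk (hσ : IsAdmissible x φ b v σ) (g : F (k + 2)) (p : ℕ) :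
    φ p ∘ₗ (σ (p + 1) ∘ₗ TensorProduct.mk R _ _ g) =
      (σ p ∘ₗ TensorProduct.mk R _ _ g) ∘ₗ boundary x p := by
  rw [← LinearMap.comp_assoc, hσ.comm]
  rfl

theorem IsAdmissible.top_apply (hσ : IsAdmissible x φ b v σ) (g : F (k + 2)) :
    σ (k + 2) (g ⊗ₜ e R (Index.full (k + 2))) = (-1 : R) ^ (k + 2) • g := by
  have : σ (k + 2) ∘ₗ (TensorProduct.mk R _ _).flip (e R (Index.full (k + 2))) =
      (-1 : R) ^ (k + 2) • LinearMap.id := b.ext hσ.top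
  exact LinearMap.congr_fun this g

theorem exists_eq_tmul_index_zero {n : ℕ} {G : Type v} [AddCommGroup G] [Module R G]
    (z : G ⊗[R] K R n 0) (I : Index n 0) : ∃ g : G, z = g ⊗ₜ e R I := by
  induction z using TensorProduct.induction_on with
  | zero => exact ⟨0, by rw [TensorProduct.zero_tmul]⟩
  | tmul a f =>
    refine ⟨f I • a, ?_⟩
    rw [TensorProduct.smul_tmul]
    congr 1
    ext J
    rw [eq_of_index_zero J I]
    simp [e]
  | add a b ha hb =>
    obtain ⟨a, rfl⟩ := ha
    obtain ⟨b, rfl⟩ := hb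
    exact ⟨a + b, by rw [TensorProduct.add_tmul]⟩

/-- The empty index set. -/
def emptyIndex (n : ℕ) : Index n 0 := ⟨∅, rfl⟩

/-- Injectivity of `G/QG → F_0/M`: for `z = g ⊗ e_∅` the top value of the chain map `σ(g ⊗ ·)` is
`±g`, so `g ∈ QG` by `top_mem_of_zero_mem`. -/
theorem IsAdmissible.mem_range_of_zero_mem (hσ : IsAdmissible x φ b v σ)
    (hex : ∀ p, Function.Exact (φ (p + 1)) (φ p)) (hvan : Subsingleton (F (k + 3)))
    (z : F (k + 2) ⊗[R] K R (k + 2) 0) (hz : σ 0 z ∈ LinearMap.range (φ 0)) :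
    z ∈ LinearMap.range (LinearMap.lTensor (F (k + 2)) (boundary x 0)) := by
  obtain ⟨g, rfl⟩ := exists_eq_tmul_index_zero z (emptyIndex _)
  obtain ⟨y, hy⟩ := top_mem_of_zero_mem
    (ρ := fun p => σ p ∘ₗ TensorProduct.mk R _ _ g) hex hvan (hσ.comm_mk g) fun I => by
    rw [eq_of_index_zero I (emptyIndex _)]
    exact hz
  have hg : g = ∑ i, x i • ((-1 : R) ^ (k + 2) • y i) := by
    have := (hσ.top_apply g).symm.trans hy
    simp only [smul_comm (x _), ← Finset.smul_sum]
    rw [← this, smul_smul, ← mul_pow]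
    simp
  rw [hg]
  exact range_boundary_zero x _ _ _

/-- `Im *φ₁ = M :_{F₀} Q`. -/
theorem IsAdmissible.range_coneMap_zero (hσ : IsAdmissible x φ b v σ) (hx : HasDepth x)
    [∀ p, Module.Flat R (F p)] (hex : ∀ p, Function.Exact (φ (p + 1)) (φ p)) :
    (LinearMap.range (coneMap x φ σ 0)).map (coneZero R (k + 2) (F (k + 2)) F).toLinearMap =
      moduleColon (LinearMap.range (φ 0)) (Ideal.span (Set.range x)) := by
  apply le_antisymm
  · rintro _ ⟨_, ⟨⟨g, f⟩, rfl⟩, rfl⟩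
    change σ 0 g + φ 0 f ∈ _
    refine Submodule.add_mem _ ?_ fun a _ => Submodule.smul_mem _ a ⟨f, rfl⟩
    intro a ha
    obtain ⟨t, ht, -⟩ := exists_homotopy x ha
    refine ⟨σ 1 (LinearMap.lTensor _ (t 0) g), ?_⟩
    rw [← LinearMap.comp_apply, hσ.comm, LinearMap.comp_apply, ← LinearMap.lTensor_comp_apply, ht,
      LinearMap.lTensor_smul, LinearMap.lTensor_id, LinearMap.smul_apply, LinearMap.id_apply,
      map_smul]
  · intro z hz
    obtain ⟨τ, h0, hτ⟩ := exists_chainMap_of_mem_moduleColon hex hz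
    -- Chosen so that `σ_n(g ⊗ e_N) = τ_n(e_N)`; the difference of the two chain maps vanishes at
    -- the top and so lands in `M` in degree `0`.
    let g : F (k + 2) := (-1 : R) ^ (k + 2) • τ (k + 2) (e R (Index.full _))
    have hρ : ∀ p, φ p ∘ₗ (τ (p + 1) - σ (p + 1) ∘ₗ TensorProduct.mk R _ _ g) =
        (τ p - σ p ∘ₗ TensorProduct.mk R _ _ g) ∘ₗ boundary x p := fun p => by
      rw [LinearMap.comp_sub, hτ, hσ.comm_mk, LinearMap.sub_comp]
    obtain ⟨f, hf⟩ := zero_mem_of_top_mem (ρ := fun p => τ p - σ p ∘ₗ TensorProduct.mk R _ _ g) hx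
      (fun p => (hex p).linearMap_comp_eq_zero) hρ (y := 0) (by
        have := hσ.top_apply g
        simp only [LinearMap.sub_apply, LinearMap.comp_apply, TensorProduct.mk_apply]
        rw [this, smul_smul, ← mul_pow]
        simp) (emptyIndex _)
    refine ⟨_, ⟨((g ⊗ₜ e R (emptyIndex _), f) : (F (k + 2) ⊗[R] K R (k + 2) 0) × F 1), rfl⟩, ?_⟩
    change σ 0 (g ⊗ₜ e R (emptyIndex _)) + φ 0 f = z
    rw [hf, LinearMap.sub_apply, h0]
    exact add_sub_cancel _ _

end Transform

end StarTransform

/-! ### Truncating the cone to length `n - 1` -/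

namespace StarTransform

open Koszul

section Transform

variable {R : Type u} [CommRing R] {k : ℕ} {F : ℕ → Type u} [∀ p, AddCommGroup (F p)]
  [∀ p, Module R (F p)] {Λ : Type w} {x : Fin (k + 2) → R} {φ : ∀ p, F (p + 1) →ₗ[R] F p}
  {b : Module.Basis Λ R (F (k + 2))} {v : Λ → Fin (k + 2) → F (k + 1)} {U : Set (F (k + 1))}
  {σ : ∀ p, F (k + 2) ⊗[R] K R (k + 2) p →ₗ[R] F p}

theorem span_range_basis_tmul (b : Module.Basis Λ R (F (k + 2))) (p : ℕ) :
    Submodule.span R (Set.range fun q : Λ × Index (k + 2) p => b q.1 ⊗ₜ[R] e R q.2) = ⊤ := by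
  have h := (b.tensorProduct (Finsupp.basisSingleOne (R := R) (ι := Index (k + 2) p))).span_eq
  rw [← h]
  congr 2
  ext q
  rw [Module.Basis.tensorProduct_apply, Finsupp.coe_basisSingleOne, e]

theorem starTop_eq_prod (b : Module.Basis Λ R (F (k + 2))) (U : Set (F (k + 1))) :
    starTop b U = (Submodule.prod (⊤ : Submodule R (F (k + 2) ⊗[R] K R (k + 2) k))
      (Submodule.span R U)).map (coneSucc R (k + 2) (F (k + 2)) F k).symm.toLinearMap := by
  rw [starTop, Submodule.span_union]
  congr 1
  have h1 : Set.range (fun q : Λ × Index (k + 2) k => (b q.1 ⊗ₜ[R] e R q.2, (0 : F (k + 1)))) =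
      LinearMap.inl R _ _ '' Set.range fun q : Λ × Index (k + 2) k => b q.1 ⊗ₜ[R] e R q.2 := by
    rw [← Set.range_comp]
    rfl
  have h2 : (fun u => ((0 : F (k + 2) ⊗[R] K R (k + 2) k), u)) '' U =
      LinearMap.inr R _ _ '' U := rfl
  rw [h1, h2, Submodule.span_image, Submodule.span_image, span_range_basis_tmul]
  apply le_antisymm
  · rw [sup_le_iff, Submodule.map_le_iff_le_comap, Submodule.map_le_iff_le_comap]
    exact ⟨fun g _ => ⟨trivial, Submodule.zero_mem _⟩, fun f hf => ⟨trivial, hf⟩⟩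
  · rintro ⟨g, f⟩ ⟨-, hf⟩
    exact Submodule.mem_sup.2 ⟨(g, 0), ⟨g, trivial, rfl⟩, (0, f), ⟨f, hf, rfl⟩, by simp⟩

theorem mem_starTop (g : F (k + 2) ⊗[R] K R (k + 2) k) (f : F (k + 1)) :
    (show Cone R (k + 2) (F (k + 2)) F (k + 1) from (g, f)) ∈ starTop b U ↔
      f ∈ Submodule.span R U := by
  rw [starTop_eq_prod]
  constructor
  · rintro ⟨_, ⟨-, h⟩, rfl⟩
    exact h
  · exact fun h => ⟨(g, f), ⟨trivial, h⟩, rfl⟩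

/-- The top term of the truncated complex is `(F_n ⊗ K_{n-2}) ⊕ ⟨U⟩`. -/
noncomputable def starTopEquiv (b : Module.Basis Λ R (F (k + 2))) (U : Set (F (k + 1))) :
    starTop b U ≃ₗ[R] (F (k + 2) ⊗[R] K R (k + 2) k) × Submodule.span R U where
  toFun z := ((coneSucc R _ _ F k z.1).1, ⟨(coneSucc R _ _ F k z.1).2, (mem_starTop _ _).1 z.2⟩)
  map_add' _ _ := rfl
  map_smul' _ _ := rfl
  invFun z := ⟨(coneSucc R _ _ F k).symm (z.1, z.2.1), (mem_starTop _ _).2 z.2.2⟩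
  left_inv _ := rfl
  right_inv _ := rfl

theorem free_starSub [∀ p, Module.Free R (F p)]
    (hU : LinearIndependent R (fun u : U => (u : F (k + 1)))) (p : ℕ) :
    Module.Free R (starSub b U p) := by
  rcases lt_trichotomy p (k + 1) with h | rfl | h
  · rw [starSub_of_le b U (Nat.lt_succ_iff.1 h)]
    exact Module.Free.of_equiv Submodule.topEquiv.symm
  · rw [starSub_top]
    have hs : Module.Free R (Submodule.span R U) := by
      have := Module.Free.of_basis (Module.Basis.span hU)
      rwa [Subtype.range_coe] at this
    exact Module.Free.of_equiv (starTopEquiv b U).symm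
  · rw [starSub_of_lt b U h]
    infer_instance

theorem subsingleton_starSub {p : ℕ} (hp : k + 1 < p) : Subsingleton (starSub b U p) := by
  rw [starSub_of_lt b U hp]
  infer_instance

/-- `σ_{n-1}` has a left inverse `r` that kills `U`: on the basis of `F_{n-1}` it sends `v_(λ,i)`
back to `±(v_λ ⊗ e_{N \ {i}})` and `U` to zero. -/
theorem IsAdmissible.eq_zero_of_mem_span (hσ : IsAdmissible x φ b v σ)
    (hU : LinearIndependent R
      (Sum.elim (fun q : Λ × Fin (k + 2) => v q.1 q.2) (fun u : U => (u : F (k + 1)))))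
    (hU' : Submodule.span R (Set.range (fun q : Λ × Fin (k + 2) => v q.1 q.2) ∪ U) = ⊤)
    {g : F (k + 2) ⊗[R] K R (k + 2) (k + 1)} (hg : σ (k + 1) g ∈ Submodule.span R U) : g = 0 := by
  let C := Module.Basis.mk hU (by rw [Set.Sum.elim_range, Subtype.range_coe, hU'])
  let y : (Λ × Fin (k + 2)) ⊕ U → F (k + 2) ⊗[R] K R (k + 2) (k + 1) := Sum.elim
    (fun q => (-1 : R) ^ (k + 2 + q.2.1) • b q.1 ⊗ₜ[R] e R (Index.compl q.2)) fun _ => 0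
  let r : F (k + 1) →ₗ[R] F (k + 2) ⊗[R] K R (k + 2) (k + 1) := C.constr R y
  have hr0 : Submodule.span R U ≤ LinearMap.ker r := by
    refine Submodule.span_le.2 fun u hu => ?_
    have := C.constr_basis R y (Sum.inr ⟨u, hu⟩)
    rwa [Module.Basis.mk_apply] at this
  have hr : r ∘ₗ σ (k + 1) = LinearMap.id := by
    refine LinearMap.ext_on_range (span_range_basis_tmul b (k + 1)) ?_
    rintro ⟨l, I⟩
    obtain ⟨i, rfl⟩ := (compl_bijective (k + 1)).2 I
    have := C.constr_basis R y (Sum.inl (l, i))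
    rw [Module.Basis.mk_apply] at this
    change r (σ (k + 1) (b l ⊗ₜ e R (Index.compl i))) = b l ⊗ₜ e R (Index.compl i)
    rw [hσ.sub_top, map_smul]
    refine (congrArg _ this).trans ?_
    simp only [y, Sum.elim_inl]
    rw [smul_smul, ← mul_pow]
    simp
  rw [← LinearMap.id_apply (R := R) g, ← hr, LinearMap.comp_apply]
  exact hr0 hg

/-- Shrinking the term of degree `n - 1` loses no boundaries: the `v_(λ,i)` lie in the image of
`σ_{n-1}`, so their part of the `F_{n-1}` component can be removed by subtracting a boundary of the
cone. -/
theorem IsAdmissible.exists_mem_starSub (hσ : IsAdmissible x φ b v σ)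
    (hcx : ∀ p, φ p ∘ₗ φ (p + 1) = 0)
    (hU' : Submodule.span R (Set.range (fun q : Λ × Fin (k + 2) => v q.1 q.2) ∪ U) = ⊤)
    {p : ℕ} (hp : p ≤ k) (w : Cone R (k + 2) (F (k + 2)) F (p + 1)) :
    ∃ w' ∈ starSub b U (p + 1), coneMap x φ σ p w' = coneMap x φ σ p w := by
  rcases hp.lt_or_eq with h | rfl
  · exact ⟨w, by rw [starSub_of_le b U h]; trivial, rfl⟩
  · obtain ⟨g, f⟩ := (w : (F (p + 2) ⊗[R] K R (p + 2) p) × F (p + 1))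
    have hf : f ∈ LinearMap.range (σ (p + 1)) ⊔ Submodule.span R U := by
      have : f ∈ (⊤ : Submodule R (F (p + 1))) := trivial
      rw [← hU', Submodule.span_union] at this
      suffices h : Submodule.span R (Set.range fun q : Λ × Fin (p + 2) => v q.1 q.2) ≤
        LinearMap.range (σ (p + 1)) from (sup_le_sup_right h _) this
      refine Submodule.span_le.2 ?_
      rintro _ ⟨⟨l, i⟩, rfl⟩
      refine ⟨(-1 : R) ^ (p + 2 + i.1) • b l ⊗ₜ[R] e R (Index.compl i), ?_⟩
      rw [map_smul, hσ.sub_top, smul_smul, ← mul_pow]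
      simp
    obtain ⟨_, ⟨g', rfl⟩, f', hf', rfl⟩ := Submodule.mem_sup.1 hf
    -- The sign cancels that of the cone differential, so the `F_{n-1}` component of `c` is exactly
    -- `σ_{n-1}(g')`.
    let c : Cone R (p + 2) (F (p + 2)) F (p + 1) := coneMap x φ σ (p + 1)
      (show (F (p + 2) ⊗[R] K R (p + 2) (p + 1)) × F (p + 2) from ((-1 : R) ^ (p + 1) • g', 0))
    refine ⟨(show Cone R (p + 2) (F (p + 2)) F (p + 1) from (g, σ (p + 1) g' + f')) - c, ?_, ?_⟩
    · rw [starSub_top]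
      refine (mem_starTop _ _).2 ?_
      change σ (p + 1) g' + f' - ((-1 : R) ^ (p + 1) • σ (p + 1) ((-1 : R) ^ (p + 1) • g') +
        φ (p + 1) 0) ∈ _
      rw [map_smul, smul_smul, ← mul_pow, map_zero]
      simpa using hf'
    · have hc : coneMap x φ σ p c = 0 := coneMap_coneMap hcx hσ.comm p _
      rw [map_sub, hc]
      exact sub_zero _

/-- Injectivity of the last differential. A cycle is the boundary of some `(g, f)` in degree `n`; a
boundary from `G ⊗ K_n` removes `f`, and the remaining `g'` satisfies `σ_{n-1}(g') ∈ ⟨U⟩`, hence is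
zero. -/
theorem IsAdmissible.eq_zero_of_mem_starTop (hσ : IsAdmissible x φ b v σ)
    (hex : ∀ p, Function.Exact (coneMap x φ σ (p + 1)) (coneMap x φ σ p))
    (hU : LinearIndependent R
      (Sum.elim (fun q : Λ × Fin (k + 2) => v q.1 q.2) (fun u : U => (u : F (k + 1)))))
    (hU' : Submodule.span R (Set.range (fun q : Λ × Fin (k + 2) => v q.1 q.2) ∪ U) = ⊤)
    {z : Cone R (k + 2) (F (k + 2)) F (k + 1)} (hz : z ∈ starTop b U)
    (h0 : coneMap x φ σ k z = 0) : z = 0 := by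
  obtain ⟨⟨g, f⟩, rfl⟩ := (hex k z).1 h0
  -- The `F_n` component of the boundary of `(h, 0)` is `(-1)^n σ_n(h) = f`.
  let h : F (k + 2) ⊗[R] K R (k + 2) (k + 2) := f ⊗ₜ e R (Index.full (k + 2))
  let c : Cone R (k + 2) (F (k + 2)) F (k + 2) :=
    coneMap x φ σ (k + 2) (show (F (k + 2) ⊗[R] K R (k + 2) (k + 2)) × F (k + 3) from (h, 0))
  have hc : (show Cone R (k + 2) (F (k + 2)) F (k + 2) from (g, f)) =
      (show Cone R (k + 2) (F (k + 2)) F (k + 2) from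
        (g - LinearMap.lTensor _ (boundary x (k + 1)) h, 0)) + c := by
    refine Prod.ext (sub_add_cancel _ _).symm ?_
    change f = 0 + ((-1 : R) ^ (k + 2) • σ (k + 2) h + φ (k + 2) 0)
    rw [hσ.top_apply, smul_smul, ← mul_pow, map_zero]
    simp
  have hcc : coneMap x φ σ (k + 1) c = 0 := (hex (k + 1) _).2 ⟨_, rfl⟩
  have heq : coneMap x φ σ (k + 1) (show Cone R (k + 2) (F (k + 2)) F (k + 2) from (g, f)) =
      coneMap x φ σ (k + 1) (show Cone R (k + 2) (F (k + 2)) F (k + 2) from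
        (g - LinearMap.lTensor _ (boundary x (k + 1)) h, 0)) := by
    rw [hc, map_add, hcc, add_zero]
  change coneMap x φ σ (k + 1) (show Cone R (k + 2) (F (k + 2)) F (k + 2) from (g, f)) ∈ _ at hz
  change coneMap x φ σ (k + 1) (show Cone R (k + 2) (F (k + 2)) F (k + 2) from (g, f)) = 0
  rw [heq] at hz ⊢
  generalize g - LinearMap.lTensor _ (boundary x (k + 1)) h = g' at hz ⊢
  have hz' : (-1 : R) ^ (k + 1) • σ (k + 1) g' + φ (k + 1) 0 ∈ Submodule.span R U :=
    (mem_starTop _ _).1 hz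
  rw [map_zero, add_zero] at hz'
  have hz2 := Submodule.smul_mem _ ((-1 : R) ^ (k + 1)) hz'
  rw [smul_smul, ← mul_pow] at hz2
  have : g' = 0 := hσ.eq_zero_of_mem_span hU hU' (by simpa using hz2)
  subst this
  exact map_zero (coneMap x φ σ (k + 1))

theorem IsAdmissible.starMap_exact (hσ : IsAdmissible x φ b v σ)
    (hcx : ∀ p, φ p ∘ₗ φ (p + 1) = 0)
    (hex : ∀ p, Function.Exact (coneMap x φ σ (p + 1)) (coneMap x φ σ p))
    (hU : LinearIndependent R
      (Sum.elim (fun q : Λ × Fin (k + 2) => v q.1 q.2) (fun u : U => (u : F (k + 1)))))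
    (hU' : Submodule.span R (Set.range (fun q : Λ × Fin (k + 2) => v q.1 q.2) ∪ U) = ⊤) (p : ℕ) :
    Function.Exact (starMap x φ b U σ (p + 1)) (starMap x φ b U σ p) := by
  rintro ⟨z, hz⟩
  constructor
  · intro h0
    have h0' : coneMap x φ σ p z = 0 := congrArg Subtype.val h0
    rcases Nat.lt_or_ge p k with h | h
    · obtain ⟨w, rfl⟩ := (hex p z).1 h0'
      obtain ⟨w', hw', h'⟩ := hσ.exists_mem_starSub hcx hU' (show p + 1 ≤ k from h) w
      exact ⟨⟨w', hw'⟩, Subtype.ext h'⟩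
    -- Here `z` has degree at least `n - 1`, with nothing above it, so it must itself vanish.
    · refine ⟨0, (map_zero _).trans (Subtype.ext (Eq.symm ?_))⟩
      change z = 0
      rcases h.eq_or_lt with rfl | h
      · rw [starSub_top] at hz
        exact hσ.eq_zero_of_mem_starTop hex hU hU' hz h0'
      · rwa [starSub_of_lt b U (by omega), Submodule.mem_bot] at hz
  · rintro ⟨w, hw⟩
    rw [← hw]
    exact Subtype.ext (coneMap_coneMap hcx hσ.comm p w.1)

theorem IsAdmissible.starAug_exact (hσ : IsAdmissible x φ b v σ) (hx : HasDepth x)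
    [∀ p, Module.Flat R (F p)] (hex : ∀ p, Function.Exact (φ (p + 1)) (φ p))
    (hU' : Submodule.span R (Set.range (fun q : Λ × Fin (k + 2) => v q.1 q.2) ∪ U) = ⊤) :
    Function.Exact (starMap x φ b U σ 0)
      (starAug b U (moduleColon (LinearMap.range (φ 0)) (Ideal.span (Set.range x)))) := by
  rintro ⟨z, hz⟩
  have hcx : ∀ p, φ p ∘ₗ φ (p + 1) = 0 := fun p => (hex p).linearMap_comp_eq_zero
  change Submodule.Quotient.mk (coneZero R (k + 2) (F (k + 2)) F z) = 0 ↔ _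
  rw [Submodule.Quotient.mk_eq_zero, ← hσ.range_coneMap_zero hx hex]
  constructor
  · rintro ⟨_, ⟨w, rfl⟩, hw⟩
    obtain rfl := (coneZero R (k + 2) (F (k + 2)) F).injective hw
    obtain ⟨w', hw', h'⟩ := hσ.exists_mem_starSub hcx hU' (Nat.zero_le k) w
    exact ⟨⟨w', hw'⟩, Subtype.ext h'⟩
  · rintro ⟨w, hw⟩
    exact ⟨z, ⟨w.1, congrArg Subtype.val hw⟩, rfl⟩

theorem starAug_surjective (A : Submodule R (F 0)) : Function.Surjective (starAug b U A) := by
  intro y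
  obtain ⟨z, rfl⟩ := A.mkQ_surjective y
  exact ⟨⟨(coneZero R (k + 2) (F (k + 2)) F).symm z, by
    rw [starSub_of_le b U (Nat.zero_le k)]; trivial⟩, rfl⟩

end Transform

end StarTransform

/-! ### Positive depth and the main theorem -/

/-- Prime avoidance: an ideal of zero divisors on `N` lies in a single associated prime, the
annihilator of some `z`. Then `I` kills `z`, so `z = 0` and the prime would be the whole ring. -/
theorem exists_isSMulRegular_of_forall_eq_zero {R : Type u} [CommRing R] [IsNoetherianRing R]
    {N : Type v} [AddCommGroup N] [Module R N] [Module.Finite R N] (I : Ideal R)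
    (h : ∀ z : N, (∀ a ∈ I, a • z = 0) → z = 0) : ∃ a ∈ I, IsSMulRegular N a := by
  by_contra! hI
  have hsub : (I : Set R) ⊆ ⋃ P ∈ associatedPrimes R N, (P : Set R) := by
    rw [biUnion_associatedPrimes_eq_compl_regular]
    exact hI
  have hfin : (associatedPrimes R N).Finite := associatedPrimes.finite R N
  obtain ⟨P, hP, hle⟩ := (Ideal.subset_union_prime (s := hfin.toFinset) (f := id) ⊥ ⊥
    fun P hP _ _ => IsAssociatedPrime.isPrime (hfin.mem_toFinset.1 hP)).1 (by simpa using hsub)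
  have hPass := hfin.mem_toFinset.1 hP
  rw [AssociatedPrimes.mem_iff, isAssociatedPrime_iff] at hPass
  obtain ⟨hp, z, rfl⟩ := hPass
  have hz : z = 0 := h z fun a ha => by simpa using hle ha
  subst hz
  exact hp.ne_top (by simp)

theorem moduleDepth_pos_of_isSMulRegular {R : Type u} [CommRing R] [IsLocalRing R] {N : Type v}
    [AddCommGroup N] [Module R N] {a : R} (ha : a ∈ IsLocalRing.maximalIdeal R)
    (h : IsSMulRegular N a) : 0 < moduleDepth R N := by
  have : ((([a] : List R).length : ℕ) : ℕ∞) ≤ moduleDepth R N :=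
    le_iSup₂_of_le (f := fun (rs : List R) (_ : (∀ r ∈ rs, r ∈ IsLocalRing.maximalIdeal R) ∧
      RingTheory.Sequence.IsWeaklyRegular N rs) => (rs.length : ℕ∞)) [a]
      ⟨by simpa using ha, by simpa using h⟩ le_rfl
  exact lt_of_lt_of_le (by simp) this

theorem theorem3p4 {R : Type u} [CommRing R] [IsLocalRing R] (hR : IsCohenMacaulayLocal R)
    -- the dimension is `n = k + 2`
    (k : ℕ) (x : Fin (k + 2) → R) (hx : IsSystemOfParameters x)
    -- the given acyclic complex of length `n`; `φ p` is the differential `F_{p+1} → F_p`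
    (F : ℕ → Type u) [∀ p, AddCommGroup (F p)] [∀ p, Module R (F p)]
    (φ : ∀ p, F (p + 1) →ₗ[R] F p) (hF : IsFreeAcyclicComplex F φ (k + 2))
    -- the free basis `v_λ` of `F_n` and the elements `v_{(λ,i)}` of `F_{n-1}`
    {Λ : Type w} (b : Module.Basis Λ R (F (k + 2))) (v : Λ → Fin (k + 2) → F (k + 1))
    (hv : ∀ l, φ (k + 1) (b l) = ∑ i, x i • v l i)
    -- the `v_{(λ,i)}` together with `U` are a free basis of `F_{n-1}`
    (U : Set (F (k + 1)))
    (hU : LinearIndependent R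
      (Sum.elim (fun q : Λ × Fin (k + 2) => v q.1 q.2) (fun u : U => (u : F (k + 1)))))
    (hU' : Submodule.span R
      (Set.range (fun q : Λ × Fin (k + 2) => v q.1 q.2) ∪ U) = ⊤) :
    (∃ σ, StarTransform.IsAdmissible x φ b v σ) ∧
    (∀ σ, StarTransform.IsAdmissible x φ b v σ →
      IsFreeAcyclicComplex (fun p => StarTransform.starSub b U p) (StarTransform.starMap x φ b U σ) (k + 1) ∧
      -- the complex resolves `F₀ / (M :_{F₀} Q)`
      Function.Exact (StarTransform.starMap x φ b U σ 0)
        (StarTransform.starAug b U (moduleColon (LinearMap.range (φ 0)) (Ideal.span (Set.range x)))) ∧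
      Function.Surjective
        (StarTransform.starAug b U (moduleColon (LinearMap.range (φ 0)) (Ideal.span (Set.range x))))) ∧
    0 < moduleDepth R
      (F 0 ⧸ moduleColon (LinearMap.range (φ 0)) (Ideal.span (Set.range x))) := by
  have := hR.noetherian
  have hd := Koszul.hasDepth_of_isSystemOfParameters hR hx
  have := hF.free
  have := hF.finite
  have hcx : ∀ p, φ p ∘ₗ φ (p + 1) = 0 := fun p => (hF.exact p).linearMap_comp_eq_zero
  have hvan : Subsingleton (F (k + 3)) := hF.vanish _ (by omega)
  have hA := StarTransform.exists_isAdmissible hd hcx hv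
  have hU₂ : LinearIndependent R (fun u : U => (u : F (k + 1))) :=
    hU.comp Sum.inr Sum.inr_injective
  have main : ∀ σ, StarTransform.IsAdmissible x φ b v σ →
      IsFreeAcyclicComplex (fun p => StarTransform.starSub b U p)
        (StarTransform.starMap x φ b U σ) (k + 1) := fun σ hσ =>
    { free := StarTransform.free_starSub hU₂
      -- Submodules of finite modules over the Noetherian ring `R`.
      finite := fun p => inferInstance
      vanish := fun p hp => StarTransform.subsingleton_starSub hp
      exact := hσ.starMap_exact hcx (StarTransform.coneMap_exact hF.exact hσ.comm
        (fun p z hz => hd.cycle p hz) (hσ.mem_range_of_zero_mem hF.exact hvan)) hU hU' }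
  refine ⟨hA, fun σ hσ => ⟨main σ hσ, hσ.starAug_exact hd hF.exact hU',
    StarTransform.starAug_surjective _⟩, ?_⟩
  obtain ⟨σ, hσ⟩ := hA
  have hex := hσ.starAug_exact hd hF.exact hU'
  have := (main σ hσ).free
  obtain ⟨a, ha, hreg⟩ := exists_isSMulRegular_of_forall_eq_zero
    (N := F 0 ⧸ moduleColon (LinearMap.range (φ 0)) (Ideal.span (Set.range x)))
    (Ideal.span (Set.range x)) fun y hy => by
      obtain ⟨z, rfl⟩ := StarTransform.starAug_surjective (b := b) (U := U) _ y
      -- The new complex has length `n - 1`, so its term of degree `n` is zero and the image of its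
      -- first differential equals its own colon by `Q`. An element of the quotient killed by `Q`
      -- lifts into that colon.
      refine (hex z).2 (Koszul.moduleColon_range_le
        (F := fun p => StarTransform.starSub b U p) (φ := StarTransform.starMap x φ b U σ) hd
        (main σ hσ).exact ((main σ hσ).vanish _ (by omega)) fun a ha => (hex (a • z)).1 ?_)
      rw [map_smul, hy a ha]
  refine moduleDepth_pos_of_isSMulRegular ?_ hreg
  rw [← hx.radical_eq]
  exact Ideal.le_radical ha
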